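/- A language is a set $L\subseteq\{0,1\}^*$, identified with its characteristic function $\{0,1\}^*\to\{0,1\}$. For oracles $A_0,A_1\subseteq\{0,1\}^*$, a machine $M^{A_0,A_1}$ has access to the oracle $A=\{\,i\cdot q : i\in\{0,1\},\ q\in A_i\,\}$, so that $A(i\cdot q)=A_i(q)$. A polynomial-time oracle machine is an oracle Turing machine that, for every oracle, halts on all inputs within a number of steps polynomial in the total length of its inputs. A probabilistic polynomial-time oracle machine is a polynomial-time oracle machine that receives, besides its input $x$, a uniformly random string $r\in\{0,1\}^{t(|x|)}$ of coin flips, where $t$ is a polynomial. - $L$ is *paddable* if there is a polynomial-time Turing machine that, on input $(x,1^m)$ with $|x|\le m$, outputs a string $y$ of length $m$ such that $y\in L$ if and only if $x\in L$. - A *(probabilistic) selector* for $L$ is a probabilistic polynomial-time oracle machine $S$ such that for all $x\in\{0,1\}^*$ and all oracles $A_0,A_1\subseteq\{0,1\}^*$ with $L\in\{A_0,A_1\}$, $$\Pr\left[S^{A_0,A_1}(x)=L(x)\right]\ge \tfrac23 ,$$ the probability being over the coin flips of $S$. - $L\in\mathrm{BPP}^R$ if there is a probabilistic polynomial-time oracle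 machine $M$ with $\Pr[M^R(x)=L(x)]\ge\frac23$ for every $x$. - $L\in\mathrm{BPP}^R/\!/\log$ if there are a polynomial-time oracle machine $M$, a polynomial $t$, a function $a:\mathbb N\to\mathbb N$ with $a(n)=O(\log n)$, and advice strings $\alpha_n(r)\in\{0,1\}^{a(n)}$ for $n\in\mathbb N$ and $r\in\{0,1\}^{t(n)}$ (so the advice may depend on the coin flips and on the input length), such that for every $n\in\mathbb N$ $$\Pr_{r\in\{0,1\}^{t(n)}}\left[\forall x\in\{0,1\}^n,\ M^R(x,r,\alpha_n(r))=L(x)\right]\ge\tfrac56 .$$ **Theorem.** Let $L$ be an arbitrary paddable language. The following are equivalent: 1. There exists a selector for $L$. 2. For every oracle $R\subseteq\{0,1\}^*$, $L\in\mathrm{BPP}^R/\!/\log$ implies $L\in\mathrm{BPP}^R$. -/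

import Mathlib

open Filter Asymptotics

noncomputable section

/-- A multi-tape oracle Turing machine with `k` input tapes over the alphabet `{0, 1}`.  It is a
machine of Mathlib's multi-stack model `Turing.TM2` (finitely many stacks, a finite set `Λ` of
control states, a finite memory `σ`; two stacks make up one two-way tape), extended by query states.
The stacks are the `k` input tapes and the finitely many tapes in `W`, among which there are a query
tape and an output tape.  The top of a stack is the first symbol of the string on it. -/
structure OracleTM (k : ℕ) where
  /-- the tapes other than the input tapes -/
  W : Type
  [decEqW : DecidableEq W]
  [finiteW : Finite W]
  /-- the control states -/
  Λ : Type
  [finiteΛ : Finite Λ]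
  /-- the values of the internal memory -/
  σ : Type
  [finiteσ : Finite σ]
  /-- the query tape -/
  queryTape : W
  /-- the output tape -/
  outputTape : W
  /-- the initial control state -/
  main : Λ
  /-- the initial value of the memory -/
  init : σ
  /-- `query l = some (yes, no)` says that `l` is a query state, which is left for the state `yes`
  or `no` according to the oracle's answer; other states have `query l = none` -/
  query : Λ → Option (Λ × Λ)
  /-- the ordinary transitions (used in the states that are not query states) -/
  prog : Λ → Turing.TM2.Stmt (fun _ : Fin k ⊕ W => Bool) Λ σ

namespace OracleTM

attribute [instance] OracleTM.decEqW OracleTM.finiteW OracleTM.finiteΛ OracleTM.finiteσ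

variable {k : ℕ} (M : OracleTM k)

/-- Configurations: a control state (`none` when the machine has halted), the memory and the
contents of the tapes. -/
abbrev Cfg : Type := Turing.TM2.Cfg (fun _ : Fin k ⊕ M.W => Bool) M.Λ M.σ

open Classical in
/-- One step of computation with oracle `A`.  A query costs one step and erases the query tape. -/
def step (A : Language Bool) : M.Cfg → Option M.Cfg
  | ⟨none, _, _⟩ => none
  | ⟨some l, v, S⟩ =>
    match M.query l with
    | some (yes, no) =>
        some ⟨some (if S (Sum.inr M.queryTape) ∈ A then yes else no), v,
          Function.update S (Sum.inr M.queryTape) []⟩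
    | none => Turing.TM2.step M.prog ⟨some l, v, S⟩

/-- The initial configuration: the strings `u i` are on the input tapes, the other tapes are
empty. -/
def initCfg (u : Fin k → List Bool) : M.Cfg :=
  ⟨some M.main, M.init, Sum.elim u (fun _ => [])⟩

/-- The configuration after `n` steps with oracle `A` on the inputs `u` (a machine that has halted
stays where it is). -/
def run (A : Language Bool) (u : Fin k → List Bool) (n : ℕ) : M.Cfg :=
  (fun c => (M.step A c).getD c)^[n] (M.initCfg u)

/-- With oracle `A`, on the inputs `u`, the machine halts with output `y`. -/
def Outputs (A : Language Bool) (u : Fin k → List Bool) (y : List Bool) : Prop :=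
  ∃ n, (M.run A u n).l = none ∧ (M.run A u n).stk (Sum.inr M.outputTape) = y

/-- The machine runs in polynomial time: for every oracle and all inputs it halts within a number
of steps that is polynomial in the total length of the inputs. -/
def PolyTime : Prop :=
  ∃ p : Polynomial ℕ, ∀ (A : Language Bool) (u : Fin k → List Bool),
    (M.run A u (p.eval (∑ i, (u i).length))).l = none

/-- The machine has no query state, so it is an ordinary Turing machine. -/
def OracleFree : Prop := ∀ l, M.query l = none

end OracleTM

open Classical in
/-- The value `L(x) ∈ {0, 1}` of the characteristic function of `L`, as a string of one bit. -/
def charBit (L : Language Bool) (x : List Bool) : List Bool := [decide (x ∈ L)]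

open Classical in
/-- The probability of `P r` for a uniformly random string `r` of `m` bits. -/
def coinProb (m : ℕ) (P : List Bool → Prop) : ℝ :=
  ((Finset.univ.filter fun r : List.Vector Bool m => P r.toList).card : ℝ) / 2 ^ m

/-- The oracle `A` with `A(i · q) = A_i(q)` for `i ∈ {0, 1}`. -/
def joinOracle (A₀ A₁ : Language Bool) : Language Bool :=
  {w | ∃ q, (w = false :: q ∧ q ∈ A₀) ∨ (w = true :: q ∧ q ∈ A₁)}

/-- `L` is paddable: a polynomial-time machine, on input `(x, 1^m)` with `|x| ≤ m`, outputs a string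
`y` of length `m` with `y ∈ L ↔ x ∈ L`. -/
def Paddable (L : Language Bool) : Prop :=
  ∃ M : OracleTM 2, M.OracleFree ∧ M.PolyTime ∧
    ∀ (x : List Bool) (m : ℕ), x.length ≤ m →
      ∃ y : List Bool, M.Outputs ⊥ ![x, List.replicate m true] y ∧
        y.length = m ∧ (y ∈ L ↔ x ∈ L)

/-- `L` has a (probabilistic) selector.  A probabilistic polynomial-time machine is a
polynomial-time machine with a second input tape that holds its coin flips, polynomially many in
the length of the input. -/
def HasSelector (L : Language Bool) : Prop :=
  ∃ S : OracleTM 2, S.PolyTime ∧ ∃ t : Polynomial ℕ,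
    ∀ (x : List Bool) (A₀ A₁ : Language Bool), L = A₀ ∨ L = A₁ →
      2 / 3 ≤ coinProb (t.eval x.length)
        (fun r => S.Outputs (joinOracle A₀ A₁) ![x, r] (charBit L x))

/-- The relativized class `BPP^R`. -/
def BPP (R : Language Bool) : Set (Language Bool) :=
  {L | ∃ M : OracleTM 2, M.PolyTime ∧ ∃ t : Polynomial ℕ, ∀ x : List Bool,
    2 / 3 ≤ coinProb (t.eval x.length) (fun r => M.Outputs R ![x, r] (charBit L x))}

/-- The relativized class `BPP^R // log`: the advice `α n r` has length `O(log n)` and may depend on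
the length `n` of the input and on the coin flips `r`; with probability at least `5/6` over `r` it
makes the machine correct on all inputs of length `n` at once. -/
def BPPCoinAdviceLog (R : Language Bool) : Set (Language Bool) :=
  {L | ∃ M : OracleTM 3, M.PolyTime ∧ ∃ (t : Polynomial ℕ) (a : ℕ → ℕ)
    (α : ℕ → List Bool → List Bool),
    ((fun n => (a n : ℝ)) =O[atTop] fun n => Real.log n) ∧
    (∀ n r, r.length = t.eval n → (α n r).length = a n) ∧
    ∀ n : ℕ, 5 / 6 ≤ coinProb (t.eval n)
      (fun r => ∀ x : List Bool, x.length = n → M.Outputs R ![x, r, α n r] (charBit L x))}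

end

/-!
# Selectors and the elimination of coin-dependent advice

**From a selector to the elimination of advice** (`HasSelector.mem_BPP`).  Let `M` decide `L` with
advice `α n r` of length `O(log n)`.  On the input `x`, fix a polynomially larger length `m` to
which all queries of the selector can be padded, flip the coins `r` of `M` for this length, and
enumerate the polynomially many candidates for `α m r`.  Each candidate gives an oracle: pad the
query to the length `m` and run `M` with the coins `r` and the candidate as advice.  With
probability at least `5/6`, the candidate `α m r` gives the oracle `L` itself.  Run the selector on all
pairs of candidates, with majority votes over independent repetitions (`coinProb_tally_le`), and
accept if some candidate wins a positive answer against all the others.  If the comparisons that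
involve the correct candidate all come out right, then so does the answer
(`AdviceSearch.head?_result_iff`), and a union bound over these comparisons leaves a probability of
at least `2/3` (`AdviceSearch.two_thirds_le_coinProb_result`).

**From the elimination of advice to a selector** (`HasSelector.of_forall_mem_BPP`).  Consider the
oracles that consist of two parts, one of which is `L`; for each length of strings, a parameter `y`
says which part it is and what the other part is (`mixedOracle`).  One bit of advice tells where
`L` is, so `L` is in `BPP` relative to each of these oracles.  The parameters form a compact space,
those for which a given machine succeeds form a closed set, and there are only countably many
machines.  By the Baire category theorem one machine succeeds for all parameters with a given
finite part.  This machine becomes a selector when its short queries are answered from a table,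
since above the level of the table any two oracles one of which is `L` may be used.

Both directions need polynomial-time oracle machines that carry out such constructions.  They are
obtained from closure properties of the class `FP` of functions of an oracle and some strings that
polynomial-time machines compute: composition (`FP.comp`), recursion on strings with polynomially
bounded values (`FP.strRec`), and substitution of a computation for the oracle (`FP.subst`).  These
in turn rest on a calculus of program fragments (`Routine`), which can be combined by flow charts
(`Routine.flow`) and can call machines while answering their queries (`Routine.call`).
-/

noncomputable section

open Turing

/-! ### Translating statements -/

/-- Transports a statement along an embedding `e` of the tapes, a lens `get`/`set` that locates the
memory inside a larger one, and a map `φ` of the control states.  Halting is replaced by a jump to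
`h` (by halting if `h = none`). -/
def trStmt {K K' Λ Λ' σ σ' : Type} (e : K → K') (get : σ' → σ) (set : σ' → σ → σ') (φ : Λ → Λ')
    (h : Option Λ') :
    TM2.Stmt (fun _ : K => Bool) Λ σ → TM2.Stmt (fun _ : K' => Bool) Λ' σ'
  | .push k f q => .push (e k) (fun m => f (get m)) (trStmt e get set φ h q)
  | .peek k f q => .peek (e k) (fun m o => set m (f (get m) o)) (trStmt e get set φ h q)
  | .pop k f q => .pop (e k) (fun m o => set m (f (get m) o)) (trStmt e get set φ h q)
  | .load f q => .load (fun m => set m (f (get m))) (trStmt e get set φ h q)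
  | .branch p q₁ q₂ =>
      .branch (fun m => p (get m)) (trStmt e get set φ h q₁) (trStmt e get set φ h q₂)
  | .goto f => .goto (fun m => φ (f (get m)))
  | .halt => match h with
    | some l => .goto fun _ => l
    | none => .halt

section trStmt

variable {K K' Λ Λ' σ σ' : Type} [DecidableEq K] [DecidableEq K']

/-- A translated statement does on the embedded tapes what the original one does, and leaves the
other tapes alone. -/
theorem stepAux_trStmt {e : K → K'} (he : e.Injective) {get : σ' → σ} {set : σ' → σ → σ'}
    (hgs : ∀ m v, get (set m v) = v) (φ : Λ → Λ') (h : Option Λ')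
    (q : TM2.Stmt (fun _ : K => Bool) Λ σ) (m : σ') (S : K' → List Bool) :
    ∃ m' S', TM2.stepAux (trStmt e get set φ h q) m S =
        ⟨((TM2.stepAux q (get m) (S ∘ e)).l.map φ).or h, m', S'⟩ ∧
      get m' = (TM2.stepAux q (get m) (S ∘ e)).var ∧
      S' ∘ e = (TM2.stepAux q (get m) (S ∘ e)).stk ∧ ∀ k ∉ Set.range e, S' k = S k := by
  induction q generalizing m S with
  | push k f q ih =>
    obtain ⟨m', S', h1, h2, h3, h4⟩ := ih m (Function.update S (e k) (f (get m) :: S (e k)))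
    have hu : Function.update S (e k) (f (get m) :: S (e k)) ∘ e =
        Function.update (S ∘ e) k (f (get m) :: (S ∘ e) k) := by
      rw [Function.update_comp_eq_of_injective _ he]; rfl
    rw [hu] at h1 h2 h3
    refine ⟨m', S', h1, h2, h3, fun k' hk' => ?_⟩
    rw [h4 k' hk', Function.update_of_ne]
    rintro rfl; exact hk' ⟨_, rfl⟩
  | peek k f q ih =>
    obtain ⟨m', S', h1, h2, h3, h4⟩ := ih (set m (f (get m) (S (e k)).head?)) S
    rw [hgs] at h1 h2 h3
    exact ⟨m', S', h1, h2, h3, h4⟩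
  | pop k f q ih =>
    obtain ⟨m', S', h1, h2, h3, h4⟩ :=
      ih (set m (f (get m) (S (e k)).head?)) (Function.update S (e k) (S (e k)).tail)
    have hu : Function.update S (e k) (S (e k)).tail ∘ e =
        Function.update (S ∘ e) k ((S ∘ e) k).tail := by
      rw [Function.update_comp_eq_of_injective _ he]; rfl
    rw [hu, hgs] at h1 h2 h3
    refine ⟨m', S', h1, h2, h3, fun k' hk' => ?_⟩
    rw [h4 k' hk', Function.update_of_ne]
    rintro rfl; exact hk' ⟨_, rfl⟩
  | load f q ih =>
    obtain ⟨m', S', h1, h2, h3, h4⟩ := ih (set m (f (get m))) S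
    rw [hgs] at h1 h2 h3
    exact ⟨m', S', h1, h2, h3, h4⟩
  | branch p q₁ q₂ ih₁ ih₂ =>
    simp only [trStmt, TM2.stepAux]
    cases p (get m)
    · exact ih₂ m S
    · exact ih₁ m S
  | goto f => exact ⟨m, S, rfl, rfl, rfl, fun _ _ => rfl⟩
  | halt =>
    cases h
    · exact ⟨m, S, rfl, rfl, rfl, fun _ _ => rfl⟩
    · exact ⟨m, S, rfl, rfl, rfl, fun _ _ => rfl⟩

end trStmt

/-! ### Program fragments -/

/-- A program fragment acting on the tapes `K`: an oracle machine for which no tape is distinguished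
except the query tape `hq`.  Halting means leaving the fragment. -/
structure Routine (K : Type) (hq : K) where
  /-- the control states -/
  Λ : Type
  [finiteΛ : Finite Λ]
  /-- the values of the internal memory -/
  σ : Type
  [finiteσ : Finite σ]
  /-- the entry point -/
  main : Λ
  /-- some value of the memory -/
  init : σ
  /-- the query states, as in `OracleTM` -/
  query : Λ → Option (Λ × Λ)
  /-- the ordinary transitions -/
  prog : Λ → TM2.Stmt (fun _ : K => Bool) Λ σ

namespace Routine

attribute [instance] Routine.finiteΛ Routine.finiteσ

variable {K : Type} [DecidableEq K] {hq : K}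

/-- Configurations of a fragment. -/
abbrev Cfg (F : Routine K hq) : Type := TM2.Cfg (fun _ : K => Bool) F.Λ F.σ

open Classical in
/-- One step of a fragment with oracle `A`; after leaving the fragment nothing happens. -/
def step (F : Routine K hq) (A : Language Bool) : F.Cfg → F.Cfg
  | ⟨none, v, S⟩ => ⟨none, v, S⟩
  | ⟨some l, v, S⟩ =>
    match F.query l with
    | some (yes, no) => ⟨some (if S hq ∈ A then yes else no), v, Function.update S hq []⟩
    | none => TM2.stepAux (F.prog l) v S

/-- From its entry point, with any memory and the tape contents `S`, the fragment `F` is left within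
`T` steps with the tape contents `S'`. -/
def Runs (F : Routine K hq) (A : Language Bool) (S : K → List Bool) (T : ℕ) (S' : K → List Bool) :
    Prop :=
  ∀ v, ∃ t ≤ T, ∃ v', (F.step A)^[t] ⟨some F.main, v, S⟩ = ⟨none, v', S'⟩

theorem Runs.mono {F : Routine K hq} {A : Language Bool} {S S' : K → List Bool} {T T' : ℕ}
    (h : F.Runs A S T S') (hT : T ≤ T') : F.Runs A S T' S' := fun v =>
  let ⟨t, ht, h⟩ := h v
  ⟨t, ht.trans hT, h⟩

theorem Runs.congr {F : Routine K hq} {A : Language Bool} {S S₁ S₂ : K → List Bool} {T : ℕ}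
    (h : F.Runs A S T S₁) (e : S₁ = S₂) : F.Runs A S T S₂ := e ▸ h

theorem step_none (F : Routine K hq) (A : Language Bool) (v : F.σ) (S : K → List Bool) (n : ℕ) :
    (F.step A)^[n] ⟨none, v, S⟩ = ⟨none, v, S⟩ :=
  Function.iterate_fixed rfl n

open Classical in
theorem step_query (F : Routine K hq) (A : Language Bool) {l yes no : F.Λ}
    (h : F.query l = some (yes, no)) (v : F.σ) (S : K → List Bool) :
    F.step A ⟨some l, v, S⟩ =
      ⟨some (if S hq ∈ A then yes else no), v, Function.update S hq []⟩ := by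
  simp only [step, h]

theorem step_prog (F : Routine K hq) (A : Language Bool) {l : F.Λ}
    (h : F.query l = none) (v : F.σ) (S : K → List Bool) :
    F.step A ⟨some l, v, S⟩ = TM2.stepAux (F.prog l) v S := by
  simp only [step, h]

/-- If the states `φ l` of `G` are translations of the states `l` of `F`, then `G` imitates `F`
until `F` is left, at which point `G` is in the state `h`. -/
theorem simulate {K' : Type} [DecidableEq K'] {hq' : K'} {F : Routine K hq} {G : Routine K' hq'}
    {e : K → K'} (he : e.Injective) (hqe : e hq = hq') {get : G.σ → F.σ} {set : G.σ → F.σ → G.σ}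
    (hgs : ∀ m v, get (set m v) = v) {φ : F.Λ → G.Λ} {h : Option G.Λ}
    (hquery : ∀ l, G.query (φ l) = (F.query l).map (Prod.map φ φ))
    (hprog : ∀ l, F.query l = none → G.prog (φ l) = trStmt e get set φ h (F.prog l))
    (A : Language Bool) (T : ℕ) :
    ∀ (l : F.Λ) (m : G.σ) (S : K' → List Bool),
      ((F.step A)^[T] ⟨some l, get m, S ∘ e⟩).l = none →
      ∃ t ≤ T, ∃ m' S', (G.step A)^[t] ⟨some (φ l), m, S⟩ = ⟨h, m', S'⟩ ∧
        S' ∘ e = ((F.step A)^[T] ⟨some l, get m, S ∘ e⟩).stk ∧ ∀ k ∉ Set.range e, S' k = S k := by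
  classical
  subst hqe
  induction T with
  | zero => intro l m S h0; simp at h0
  | succ T ih =>
    intro l m S hT
    rw [Function.iterate_succ_apply] at hT ⊢
    cases hl : F.query l with
    | some yn =>
      obtain ⟨y, n⟩ := yn
      have hu : Function.update S (e hq) [] ∘ e = Function.update (S ∘ e) hq [] := by
        rw [Function.update_comp_eq_of_injective _ he]
      rw [F.step_query A hl, ← hu] at hT ⊢
      obtain ⟨t, ht, m', S', h1, h2, h3⟩ := ih _ _ _ hT
      refine ⟨t + 1, by omega, m', S', ?_, h2, fun k hk => ?_⟩
      · rw [Function.iterate_succ_apply, G.step_query A (yes := φ y) (no := φ n)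
          (by rw [hquery, hl]; rfl), ← h1, apply_ite φ]
        rfl
      · rw [h3 k hk, Function.update_of_ne]
        rintro rfl; exact hk ⟨_, rfl⟩
    | none =>
      rw [F.step_prog A hl] at hT ⊢
      obtain ⟨m', S', h1, h2, h3, h4⟩ := stepAux_trStmt he hgs φ h (F.prog l) m S
      have hG := G.step_prog A (l := φ l) (by rw [hquery, hl]; rfl) m S
      rw [hprog l hl, h1] at hG
      generalize hc : TM2.stepAux (F.prog l) (get m) (S ∘ e) = c at *
      obtain ⟨l', v', S₁⟩ := c
      subst h2 h3
      cases l' with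
      | none =>
        refine ⟨1, by omega, m', S', hG, ?_, h4⟩
        rw [step_none]
      | some l' =>
        obtain ⟨t, ht, m'', S'', g1, g2, g3⟩ := ih _ _ _ hT
        refine ⟨t + 1, by omega, m'', S'', ?_, g2, fun k hk => (g3 k hk).trans (h4 k hk)⟩
        rw [Function.iterate_succ_apply, hG, ← g1]
        rfl

/-! ### Control structures -/

/-- A flow chart: the fragments `F i` are its nodes, and when node `i` is left, the top symbol `o`
of the tape `k` determines the next node `next i o` (the flow chart is left if this is `none`). -/
def flow {I : Type} [Finite I] [DecidableEq I] (F : I → Routine K hq) (k : K)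
    (next : I → Option Bool → Option I) (start : I) : Routine K hq where
  Λ := Σ i, Option (F i).Λ
  σ := (∀ i, (F i).σ) × Option Bool
  main := ⟨start, some (F start).main⟩
  init := (fun i => (F i).init, none)
  query
    | ⟨i, some l⟩ => ((F i).query l).map (Prod.map (fun l => ⟨i, some l⟩) (fun l => ⟨i, some l⟩))
    | ⟨_, none⟩ => none
  prog
    | ⟨i, some l⟩ => trStmt id (fun m => m.1 i) (fun m v => (Function.update m.1 i v, m.2))
        (fun l => ⟨i, some l⟩) (some ⟨i, none⟩) ((F i).prog l)
    | ⟨i, none⟩ => .peek k (fun m o => (m.1, o)) <|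
        .branch (fun m => (next i m.2).isSome)
          (.goto fun m => match next i m.2 with
            | some j => ⟨j, some (F j).main⟩
            | none => ⟨i, none⟩)
          .halt

section flow

variable {I : Type} [Finite I] [DecidableEq I] {F : I → Routine K hq} {k : K}
  {next : I → Option Bool → Option I} {A : Language Bool} {S S' S'' : K → List Bool} {t T : ℕ}

/-- From the entry point of a node, the flow chart arrives at the entry point of the next one. -/
theorem flow_node (start : I) {i : I} (h : (F i).Runs A S t S') (m : (flow F k next start).σ) :
    ∃ t' ≤ t + 1, ∃ m', ((flow F k next start).step A)^[t'] ⟨some ⟨i, some (F i).main⟩, m, S⟩ =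
      ⟨(next i (S' k).head?).map fun j => ⟨j, some (F j).main⟩, m', S'⟩ := by
  obtain ⟨t₁, ht₁, v', h⟩ := h (m.1 i)
  obtain ⟨t', ht', m', S₁, h1, h2, h3⟩ := simulate (F := F i) (G := flow F k next start)
    (e := id) Function.injective_id rfl (get := fun m => m.1 i)
    (set := fun m v => (Function.update m.1 i v, m.2)) (fun m v => by simp)
    (φ := fun l => ⟨i, some l⟩) (h := some ⟨i, none⟩) (fun l => rfl) (fun l _ => rfl) A t₁
    (F i).main m S (by rw [Function.comp_id, h])
  rw [Function.comp_id, Function.comp_id, h] at h2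
  subst h2
  refine ⟨t' + 1, by omega, (m'.1, (S₁ k).head?), ?_⟩
  rw [Function.iterate_succ_apply', h1]
  refine (step_prog (flow F k next start) A (l := ⟨i, none⟩) rfl _ _).trans ?_
  simp only [flow, TM2.stepAux]
  cases next i (S₁ k).head? <;> rfl

/-- From node `i` with tape contents `S`, the flow chart is left within `T` steps with tape contents
`S'`. -/
def FlowRuns (F : I → Routine K hq) (k : K) (next : I → Option Bool → Option I)
    (A : Language Bool) (i : I) (S : K → List Bool) (T : ℕ) (S' : K → List Bool) : Prop :=
  ∀ start m, ∃ t ≤ T, ∃ m', ((flow F k next start).step A)^[t] ⟨some ⟨i, some (F i).main⟩, m, S⟩ =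
    ⟨none, m', S'⟩

theorem FlowRuns.last {i : I} (h : (F i).Runs A S t S') (hn : next i (S' k).head? = none) :
    FlowRuns F k next A i S (t + 1) S' := fun start m => by
  have := flow_node (k := k) (next := next) start h m
  rwa [hn] at this

theorem FlowRuns.cons {i j : I} (h : (F i).Runs A S t S') (hn : next i (S' k).head? = some j)
    (h' : FlowRuns F k next A j S' T S'') : FlowRuns F k next A i S (t + 1 + T) S'' :=
  fun start m => by
    obtain ⟨t₁, ht₁, m', h1⟩ := flow_node (k := k) (next := next) start h m
    rw [hn] at h1
    obtain ⟨t₂, ht₂, m'', h2⟩ := h' start m'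
    refine ⟨t₂ + t₁, by omega, m'', ?_⟩
    rw [Function.iterate_add_apply, h1, ← h2]
    rfl

theorem FlowRuns.runs {i : I} (h : FlowRuns F k next A i S T S') :
    (flow F k next i).Runs A S T S' := h i

end flow

/-- The fragment that is left at once. -/
def skip : Routine K hq where
  Λ := Unit
  σ := Unit
  main := ()
  init := ()
  query _ := none
  prog _ := .halt

variable {A : Language Bool} {S S' S'' : K → List Bool} {t T T' : ℕ}

theorem runs_skip : (skip : Routine K hq).Runs A S 1 S := fun _ => ⟨1, le_rfl, _, rfl⟩

/-- First `F`, then `G`. -/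
def seq (F G : Routine K hq) : Routine K hq :=
  flow (fun b => bif b then F else G) hq (fun b _ => bif b then some false else none) true

theorem runs_seq {F G : Routine K hq} (hF : F.Runs A S T S') (hG : G.Runs A S' T' S'') :
    (F.seq G).Runs A S (T + T' + 2) S'' := by
  refine Runs.mono (FlowRuns.runs (FlowRuns.cons (j := false) hF rfl
    (FlowRuns.last hG rfl))) (by omega)

/-- Runs `F o`, where `o` is the top symbol of the tape `k`. -/
def caseTop (k : K) (F : Option Bool → Routine K hq) : Routine K hq :=
  flow (fun i : Option (Option Bool) => i.elim skip F) k
    (fun i o => i.elim (some (some o)) fun _ => none) none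

theorem runs_caseTop {k : K} {F : Option Bool → Routine K hq}
    (h : (F (S k).head?).Runs A S T S') : (caseTop k F).Runs A S (T + 3) S' := by
  refine Runs.mono (FlowRuns.runs (FlowRuns.cons (j := some (S k).head?) (runs_skip (S := S)) rfl
    (FlowRuns.last (i := some (S k).head?) h rfl))) (by omega)

/-- Repeats `F` as long as the tape `k` is nonempty. -/
def loop (k : K) (F : Routine K hq) : Routine K hq :=
  flow (fun b => bif b then F else skip) k
    (fun b o => bif b then some false else if o.isSome then some true else none) false

/-- The sequence `St` of tape contents is the loop invariant: `St n` are the contents after `n`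
rounds, and `L` is the number of rounds. -/
theorem runs_loop {k : K} {F : Routine K hq} (L : ℕ) (St : ℕ → K → List Bool)
    (hk : ∀ n < L, St n k ≠ []) (hL : St L k = [])
    (h : ∀ n < L, F.Runs A (St n) T (St (n + 1))) :
    (loop k F).Runs A (St 0) (L * (T + 3) + 2) (St L) := by
  suffices H : ∀ j n, n + j = L → FlowRuns (fun b => bif b then F else skip) k
      (fun b o => bif b then some false else if o.isSome then some true else none) A false (St n)
      (j * (T + 3) + 2) (St L) from FlowRuns.runs (H L 0 (by omega))
  intro j
  induction j with
  | zero =>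
    intro n hn
    obtain rfl : n = L := hn
    rw [Nat.zero_mul, Nat.zero_add]
    exact FlowRuns.last runs_skip (by simp [hL])
  | succ j ih =>
    intro n hn
    have hs : (St n k).head?.isSome := by
      cases hc : St n k with
      | nil => exact absurd hc (hk n (by omega))
      | cons => rfl
    have := FlowRuns.cons (i := false) (j := true) (S := St n) (A := A)
      (F := fun b => bif b then F else skip) (k := k)
      (next := fun b o => bif b then some false else if o.isSome then some true else none)
      runs_skip (by simp [hs]) (FlowRuns.cons (j := false) (h n (by omega)) rfl
        (ih (n + 1) (by omega)))
    intro start m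
    obtain ⟨t, ht, r⟩ := this start m
    exact ⟨t, by rw [Nat.succ_mul]; omega, r⟩

/-! ### Elementary fragments -/

/-- Pushes `b` on the tape `k`. -/
def pushBit (k : K) (b : Bool) : Routine K hq where
  Λ := Unit
  σ := Unit
  main := ()
  init := ()
  query _ := none
  prog _ := .push k (fun _ => b) .halt

theorem runs_pushBit {k : K} {b : Bool} :
    (pushBit k b : Routine K hq).Runs A S 1 (Function.update S k (b :: S k)) :=
  fun _ => ⟨1, le_rfl, _, rfl⟩

/-- Moves one symbol from the tape `a` to the tape `b`. -/
def moveOne (a b : K) : Routine K hq where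
  Λ := Unit
  σ := Option Bool
  main := ()
  init := none
  query _ := none
  prog _ := .pop a (fun _ o => o) <|
    .branch Option.isSome (.push b (fun o => o.getD false) .halt) .halt

theorem runs_moveOne {a b : K} {c : Bool} {l : List Bool} (hab : b ≠ a) (h : S a = c :: l) :
    (moveOne a b : Routine K hq).Runs A S 1
      (Function.update (Function.update S a l) b (c :: S b)) :=
  fun _ => ⟨1, le_rfl, _, by
    simp only [Function.iterate_one, step, moveOne, TM2.stepAux, h, List.head?_cons,
      Option.isSome_some, cond_true, List.tail_cons, Option.getD_some,
      Function.update_of_ne hab]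
    rfl⟩

/-- Removes the top symbol of the tape `a`. -/
def popBit (a : K) : Routine K hq where
  Λ := Unit
  σ := Unit
  main := ()
  init := ()
  query _ := none
  prog _ := .pop a (fun _ _ => ()) .halt

theorem runs_popBit {a : K} :
    (popBit a : Routine K hq).Runs A S 1 (Function.update S a (S a).tail) :=
  fun _ => ⟨1, le_rfl, _, rfl⟩

/-- Pushes the remembered symbol on all tapes in `L`, then executes `q`. -/
def pushAll {Λ : Type} (L : List K) (q : TM2.Stmt (fun _ : K => Bool) Λ (Option Bool)) :
    TM2.Stmt (fun _ : K => Bool) Λ (Option Bool) :=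
  L.foldr (fun k q => .push k (fun o => o.getD false) q) q

/-- Empties the tape `a`, moving its symbols to each of the tapes in `L` (in reversed order). -/
def moveAll (a : K) (L : List K) : Routine K hq where
  Λ := Unit
  σ := Option Bool
  main := ()
  init := none
  query _ := none
  prog _ := .pop a (fun _ o => o) <|
    .branch Option.isSome (pushAll L (.goto fun _ => ())) .halt

theorem stepAux_pushAll {Λ : Type} (L : List K) (hL : L.Nodup)
    (q : TM2.Stmt (fun _ : K => Bool) Λ (Option Bool)) (c : Bool) (S : K → List Bool) :
    TM2.stepAux (pushAll L q) (some c) S =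
      TM2.stepAux q (some c) (fun k => if k ∈ L then c :: S k else S k) := by
  induction L generalizing S with
  | nil => simp [pushAll]
  | cons a L ih =>
    rw [List.nodup_cons] at hL
    change TM2.stepAux (pushAll L q) (some c) _ = _
    rw [ih hL.2]
    congr 1
    funext k
    by_cases hk : k = a
    · subst hk; simp [hL.1]
    · simp [hk]

theorem runs_moveAll {a : K} {L : List K} (hL : L.Nodup) (ha : a ∉ L) :
    (moveAll a L : Routine K hq).Runs A S ((S a).length + 1)
      (fun k => if k = a then [] else if k ∈ L then (S a).reverse ++ S k else S k) := by
  intro v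
  refine ⟨_, le_rfl, none, ?_⟩
  generalize hn : S a = l
  induction l generalizing S v with
  | nil =>
    simp only [List.length_nil, Nat.zero_add, Function.iterate_one, step, moveAll, TM2.stepAux, hn,
      List.head?_nil, Option.isSome_none, cond_false, List.tail_nil, List.reverse_nil,
      List.nil_append, ite_self]
    congr 1
    funext k
    by_cases hk : k = a
    · subst hk; simp
    · simp [hk]
  | cons c l ih =>
    rw [List.length_cons, Function.iterate_succ_apply]
    have : step (moveAll a L : Routine K hq) A ⟨some (moveAll a L : Routine K hq).main, v, S⟩ =
        ⟨some (), some c, fun k => if k ∈ L then c :: (Function.update S a l) k else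
          (Function.update S a l) k⟩ := by
      rw [step_prog _ _ rfl]
      simp only [moveAll, TM2.stepAux, hn, List.head?_cons, Option.isSome_some, cond_true,
        List.tail_cons]
      rw [stepAux_pushAll L hL]
      rfl
    rw [this]
    refine (ih (S := fun k => if k ∈ L then c :: (Function.update S a l) k else
          (Function.update S a l) k) (v := some c) (by simp [ha])).trans ?_
    congr 1
    funext k
    by_cases hk : k = a
    · simp [hk]
    · by_cases hkL : k ∈ L <;> simp [hk, hkL]

/-- Asks the oracle for the string on the query tape and pushes the answer on the tape `a`. -/
def queryTo (a : K) : Routine K hq where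
  Λ := Option Bool
  σ := Unit
  main := none
  init := ()
  query
    | none => some (some true, some false)
    | some _ => none
  prog
    | none => .halt
    | some b => .push a (fun _ => b) .halt

open Classical in
theorem runs_queryTo {a : K} : (queryTo a : Routine K hq).Runs A S 2
    (Function.update (Function.update S hq []) a
      (decide (S hq ∈ A) :: Function.update S hq [] a)) := by
  refine fun v => ⟨2, le_rfl, (), ?_⟩
  rw [Function.iterate_succ_apply, step_query _ A (yes := some true) (no := some false) rfl,
    Function.iterate_one]
  by_cases h : S hq ∈ A
  · simp only [h, decide_true]; rfl
  · simp only [h, decide_false]; rfl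

end Routine

/-! ### Tape lengths, and the part of the oracle that matters -/

/-- The number of `push` instructions of a statement. -/
def pushCount {K Λ σ : Type} : TM2.Stmt (fun _ : K => Bool) Λ σ → ℕ
  | .push _ _ q => pushCount q + 1
  | .peek _ _ q => pushCount q
  | .pop _ _ q => pushCount q
  | .load _ q => pushCount q
  | .branch _ q₁ q₂ => pushCount q₁ + pushCount q₂
  | .goto _ => 0
  | .halt => 0

theorem length_stepAux_le {K Λ σ : Type} [DecidableEq K] (q : TM2.Stmt (fun _ : K => Bool) Λ σ)
    (v : σ) (S : K → List Bool) (k : K) :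
    ((TM2.stepAux q v S).stk k).length ≤ (S k).length + pushCount q := by
  induction q generalizing v S with
  | push a f q ih =>
    refine (ih _ _).trans ?_
    simp only [pushCount]
    by_cases h : k = a
    · subst h; simp [Nat.add_comm, Nat.add_left_comm]
    · simp [h]
  | peek a f q ih => exact ih _ _
  | pop a f q ih =>
    refine (ih _ _).trans ?_
    simp only [pushCount]
    by_cases h : k = a
    · subst h; simp
    · simp [h]
  | load f q ih => exact ih _ _
  | branch p q₁ q₂ ih₁ ih₂ =>
    simp only [TM2.stepAux, pushCount]
    cases p v
    · exact (ih₂ v S).trans (by omega)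
    · exact (ih₁ v S).trans (by omega)
  | goto f => exact Nat.le_add_right _ _
  | halt => exact Nat.le_add_right _ _

namespace Routine

variable {K : Type} [DecidableEq K] {hq : K}

/-- Each step lengthens each tape by at most a constant. -/
theorem exists_length_le (F : Routine K hq) : ∃ c, ∀ (A : Language Bool) (x : F.Cfg) (n : ℕ) (k : K),
    (((F.step A)^[n] x).stk k).length ≤ (x.stk k).length + c * n := by
  obtain ⟨c, hc⟩ := (Set.finite_range fun l => pushCount (F.prog l)).bddAbove
  refine ⟨c, fun A x n => ?_⟩
  induction n with
  | zero => simp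
  | succ n ih =>
    intro k
    rw [Function.iterate_succ_apply']
    refine le_trans ?_ ((Nat.add_le_add_right (ih k) c).trans_eq (by ring))
    generalize (F.step A)^[n] x = y
    obtain ⟨_ | l, v, S⟩ := y
    · exact Nat.le_add_right _ _
    · cases h : F.query l with
      | some yn =>
        rw [F.step_query A h]
        by_cases hk : k = hq
        · subst hk; simp
        · simp [hk]
      | none =>
        rw [F.step_prog A h]
        exact (length_stepAux_le _ _ _ _).trans (Nat.add_le_add_left (hc ⟨l, rfl⟩) _)

/-- Two oracles with the same answers to all queries that occur lead to the same computation. -/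
theorem iterate_step_congr (F : Routine K hq) {A A' : Language Bool} (x : F.Cfg) (T : ℕ)
    (h : ∀ n < T, ((F.step A)^[n] x).stk hq ∈ A ↔ ((F.step A)^[n] x).stk hq ∈ A') :
    (F.step A)^[T] x = (F.step A')^[T] x := by
  induction T with
  | zero => rfl
  | succ T ih =>
    rw [Function.iterate_succ_apply', Function.iterate_succ_apply',
      ← ih fun n hn => h n (hn.trans T.lt_succ_self)]
    have hT := h T T.lt_succ_self
    generalize (F.step A)^[T] x = y at *
    obtain ⟨_ | l, v, S⟩ := y
    · rfl
    · cases hl : F.query l with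
      | some yn =>
        classical
        rw [F.step_query A hl, F.step_query A' hl]
        exact congrArg (fun l => (⟨some l, v, _⟩ : F.Cfg)) (if_congr hT rfl rfl)
      | none => rw [F.step_prog A hl, F.step_prog A' hl]

end Routine

namespace OracleTM

variable {k : ℕ}

/-- A machine as a program fragment on its own tapes. -/
abbrev toRoutine (M : OracleTM k) : Routine (Fin k ⊕ M.W) (Sum.inr M.queryTape) where
  Λ := M.Λ
  σ := M.σ
  main := M.main
  init := M.init
  query := M.query
  prog := M.prog

theorem run_eq (M : OracleTM k) (A : Language Bool) (u : Fin k → List Bool) (n : ℕ) :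
    M.run A u n = (M.toRoutine.step A)^[n] (M.initCfg u) := by
  have : (fun c => (M.step A c).getD c) = M.toRoutine.step A := by
    funext ⟨l, v, S⟩
    cases l with
    | none => rfl
    | some l =>
      cases h : M.query l with
      | some yn =>
        rw [M.toRoutine.step_query A h]
        simp only [step, h]
        rfl
      | none =>
        rw [M.toRoutine.step_prog A h]
        simp only [step, h]
        rfl
  rw [← this]
  rfl

theorem run_of_le (M : OracleTM k) {A : Language Bool} {u : Fin k → List Bool} {m n : ℕ}
    (h : (M.run A u m).l = none) (hmn : m ≤ n) : M.run A u n = M.run A u m := by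
  obtain ⟨d, rfl⟩ := Nat.exists_eq_add_of_le hmn
  rw [run_eq, Nat.add_comm, Function.iterate_add_apply, ← run_eq]
  generalize M.run A u m = c at h
  obtain ⟨l, v, S⟩ := c
  obtain rfl : l = none := h
  exact Routine.step_none _ _ _ _ _

theorem Outputs.eq_of_run {M : OracleTM k} {A : Language Bool} {u : Fin k → List Bool}
    {y : List Bool} {n : ℕ} (h : M.Outputs A u y) (hn : (M.run A u n).l = none) :
    (M.run A u n).stk (Sum.inr M.outputTape) = y := by
  obtain ⟨m, hm, rfl⟩ := h
  rcases le_total m n with hmn | hmn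
  · rw [M.run_of_le hm hmn]
  · rw [M.run_of_le hn hmn]

theorem Outputs.unique {M : OracleTM k} {A : Language Bool} {u : Fin k → List Bool}
    {y z : List Bool} (h : M.Outputs A u y) (h' : M.Outputs A u z) : y = z := by
  obtain ⟨n, hn, rfl⟩ := h'
  exact (h.eq_of_run hn).symm

/-- A machine makes only short queries: its computation is determined by the short strings in the
oracle. -/
theorem exists_query_bound (M : OracleTM k) : ∃ c, ∀ (A A' : Language Bool)
    (u : Fin k → List Bool) (T : ℕ), (∀ q : List Bool, q.length ≤ c * T → (q ∈ A ↔ q ∈ A')) →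
      M.run A u T = M.run A' u T := by
  obtain ⟨c, hc⟩ := M.toRoutine.exists_length_le
  refine ⟨c, fun A A' u T h => ?_⟩
  rw [run_eq, run_eq]
  refine Routine.iterate_step_congr _ _ _ fun n hn => h _ ?_
  refine (hc A _ n _).trans ?_
  have := Nat.mul_le_mul_left c hn.le
  simpa [initCfg] using this

end OracleTM

/-! ### Calling a machine, with a fragment in place of its oracle -/

namespace Routine

variable {K : Type} [DecidableEq K] {hq : K} {k : ℕ}

/-- Runs the machine `N` on the tapes `e i`; its queries are answered by the fragment `sub`, which
is to replace the query by a string of one bit, the answer. -/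
def call (N : OracleTM k) (e : Fin k ⊕ N.W → K) (sub : Routine K hq) : Routine K hq where
  Λ := Option (N.Λ ⊕ (N.Λ × N.Λ × N.σ) × Option sub.Λ)
  σ := N.σ × sub.σ × Option Bool
  main := none
  init := (N.init, sub.init, none)
  query
    | some (.inr (x, some l)) => (sub.query l).map
        (Prod.map (fun l => some (.inr (x, some l))) (fun l => some (.inr (x, some l))))
    | _ => none
  prog
    | none => .load (fun m => (N.init, m.2)) (.goto fun _ => some (.inl N.main))
    | some (.inl l) => match N.query l with
      | none => trStmt e (fun m => m.1) (fun m v => (v, m.2)) (fun l => some (.inl l)) none (N.prog l)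
      | some (yes, no) => .goto fun m => some (.inr ((yes, no, m.1), some sub.main))
    | some (.inr (x, some l)) =>
        trStmt id (fun m => m.2.1) (fun m v => (m.1, v, m.2.2)) (fun l => some (.inr (x, some l)))
          (some (some (.inr (x, none)))) (sub.prog l)
    | some (.inr ((yes, no, v), none)) => .pop (e (.inr N.queryTape)) (fun m o => (v, m.2.1, o)) <|
        .goto fun m => if m.2.2 = some true then some (.inl yes) else some (.inl no)

section call

variable {N : OracleTM k} {e : Fin k ⊕ N.W → K} {sub : Routine K hq} {A : Language Bool}
  {S S' : K → List Bool} {B : ℕ}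

open Classical in
theorem call_query {l yes no : N.Λ} (hl : N.query l = some (yes, no)) {b : Bool}
    (hsub : sub.Runs A S B (Function.update S (e (.inr N.queryTape)) [b]))
    (m : (call N e sub).σ) :
    ∃ t ≤ B + 2, ∃ m', m'.1 = m.1 ∧
      ((call N e sub).step A)^[t] ⟨some (some (.inl l)), m, S⟩ =
        ⟨some (some (.inl (if b then yes else no))), m',
          Function.update S (e (.inr N.queryTape)) []⟩ := by
  obtain ⟨t₁, ht₁, v', h⟩ := hsub m.2.1
  obtain ⟨t, ht, m', S₁, h1, h2, h3⟩ := simulate (F := sub) (G := call N e sub)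
    (e := id) Function.injective_id rfl (get := fun m => m.2.1)
    (set := fun m v => (m.1, v, m.2.2)) (fun m v => rfl)
    (φ := fun l => some (.inr ((yes, no, m.1), some l)))
    (h := some (some (.inr ((yes, no, m.1), none)))) (fun l => rfl) (fun l _ => rfl) A t₁
    sub.main m S (by rw [Function.comp_id, h])
  rw [Function.comp_id, Function.comp_id, h] at h2
  subst h2
  have h0 : (call N e sub).step A ⟨some (some (.inl l)), m, S⟩ =
      ⟨some (some (.inr ((yes, no, m.1), some sub.main))), m, S⟩ := by
    refine (step_prog (call N e sub) A (l := some (.inl l)) rfl _ _).trans ?_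
    simp only [call, hl, TM2.stepAux]
  refine ⟨t + 1 + 1, by omega, (m.1, m'.2.1, some b), rfl, ?_⟩
  rw [Function.iterate_succ_apply, h0, Function.iterate_succ_apply', h1]
  refine (step_prog (call N e sub) A (l := some (.inr ((yes, no, m.1), none))) rfl _ _).trans ?_
  simp only [call, TM2.stepAux, Function.update_self, List.head?_cons, List.tail_cons,
    Function.update_idem]
  cases b <;> rfl

open Classical in
/-- If `sub` answers the queries according to the oracle `O`, then calling `N` has the effect of
running `N` with oracle `O`. -/
theorem runs_call (he : e.Injective) {O : Language Bool} {T ℓ : ℕ}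
    (hsub : ∀ S', (∀ a ∉ Set.range e, S' a = S a) → (S' (e (.inr N.queryTape))).length ≤ ℓ →
      sub.Runs A S' B (Function.update S' (e (.inr N.queryTape))
        [decide (S' (e (.inr N.queryTape)) ∈ O)]))
    {u : Fin k → List Bool} (hS : S ∘ e = Sum.elim u fun _ => []) (hT : (N.run O u T).l = none)
    (hℓ : ∀ n < T, ((N.run O u n).stk (.inr N.queryTape)).length ≤ ℓ)
    (hS' : S' ∘ e = (N.run O u T).stk) (hSS' : ∀ a ∉ Set.range e, S' a = S a) :
    (call N e sub).Runs A S (T * (B + 2) + 1) S' := by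
  simp only [N.run_eq] at hT hℓ hS'
  suffices H : ∀ T (l : N.Λ) (m : (call N e sub).σ) (S₁ : K → List Bool),
      (∀ a ∉ Set.range e, S₁ a = S a) →
      ((N.toRoutine.step O)^[T] ⟨some l, m.1, S₁ ∘ e⟩).l = none →
      (∀ n < T, (((N.toRoutine.step O)^[n] ⟨some l, m.1, S₁ ∘ e⟩).stk
        (.inr N.queryTape)).length ≤ ℓ) →
      ∃ t ≤ T * (B + 2), ∃ m' S', ((call N e sub).step A)^[t] ⟨some (some (.inl l)), m, S₁⟩ =
        ⟨none, m', S'⟩ ∧ S' ∘ e = ((N.toRoutine.step O)^[T] ⟨some l, m.1, S₁ ∘ e⟩).stk ∧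
        ∀ a ∉ Set.range e, S' a = S a by
    intro v
    obtain ⟨t, ht, m', S₁, h1, h2, h3⟩ := H T N.main (N.init, v.2) S (fun _ _ => rfl)
      (by rw [hS]; exact hT) (by rw [hS]; exact hℓ)
    refine ⟨t + 1, by omega, m', ?_⟩
    have : S₁ = S' := by
      funext a
      by_cases ha : a ∈ Set.range e
      · obtain ⟨i, rfl⟩ := ha
        have : (S₁ ∘ e) i = (S' ∘ e) i := by rw [h2, hS', hS]; rfl
        exact this
      · rw [h3 a ha, hSS' a ha]
    rw [← this, ← h1, Function.iterate_succ_apply]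
    rfl
  intro T
  induction T with
  | zero => intro l m S₁ _ h0; simp at h0
  | succ T ih =>
    intro l m S₁ hS₁ hT hℓ
    have hℓ' := fun n (hn : n < T) => hℓ (n + 1) (by omega)
    have hℓ0 : (S₁ (e (.inr N.queryTape))).length ≤ ℓ := hℓ 0 (by omega)
    simp only [Function.iterate_succ_apply] at hT hℓ' ⊢
    cases hl : N.query l with
    | some yn =>
      obtain ⟨yes, no⟩ := yn
      obtain ⟨t₁, ht₁, m₁, hm₁, h1⟩ := call_query hl (hsub S₁ hS₁ hℓ0) m
      have hstep := N.toRoutine.step_query O hl m.1 (S₁ ∘ e)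
      have hu : Function.update (S₁ ∘ e) (Sum.inr N.queryTape) [] =
          Function.update S₁ (e (.inr N.queryTape)) [] ∘ e := by
        rw [Function.update_comp_eq_of_injective _ he]
      rw [hu, ← hm₁] at hstep
      rw [← hm₁, hstep] at hT hℓ' ⊢
      obtain ⟨t₂, ht₂, m', S', h2, h3, h4⟩ := ih _ m₁ _ (fun a ha => by
        rw [Function.update_of_ne, hS₁ a ha]; rintro rfl; exact ha ⟨_, rfl⟩) hT hℓ'
      refine ⟨t₂ + t₁, by rw [Nat.succ_mul]; omega, m', S', ?_, h3, h4⟩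
      rw [Function.iterate_add_apply, h1, ← h2]
      simp only [decide_eq_true_eq, Function.comp_apply]
    | none =>
      have hstep := N.toRoutine.step_prog O hl m.1 (S₁ ∘ e)
      rw [hstep] at hT hℓ' ⊢
      obtain ⟨m₁, S₂, h1, h2, h3, h4⟩ := stepAux_trStmt (σ' := (call N e sub).σ) he
        (get := fun m => m.1) (set := fun m v => (v, m.2)) (fun _ _ => rfl)
        (fun l => (some (.inl l) : (call N e sub).Λ)) none (N.prog l) m S₁
      have hp : (call N e sub).prog (some (.inl l)) = trStmt e (fun m => m.1)
          (fun m v => (v, m.2)) (fun l => some (.inl l)) none (N.prog l) := by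
        simp only [call, hl]
      have hG := ((step_prog (call N e sub) A (l := some (.inl l)) rfl m S₁).trans
        (congrArg (fun q => TM2.stepAux q m S₁) hp)).trans h1
      generalize TM2.stepAux (N.prog l) m.1 (S₁ ∘ e) = c at *
      obtain ⟨l', v', S₃⟩ := c
      subst h2 h3
      cases l' with
      | none =>
        refine ⟨1, by rw [Nat.succ_mul]; omega, m₁, S₂, hG, ?_,
          fun a ha => (h4 a ha).trans (hS₁ a ha)⟩
        exact congrArg TM2.Cfg.stk (N.toRoutine.step_none O _ _ T).symm
      | some l' =>
        obtain ⟨t, ht, m'', S'', g1, g2, g3⟩ := ih l' m₁ S₂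
          (fun a ha => (h4 a ha).trans (hS₁ a ha)) hT hℓ'
        refine ⟨t + 1, by rw [Nat.succ_mul]; omega, m'', S'', ?_, g2, g3⟩
        rw [Function.iterate_succ_apply, hG, ← g1]
        rfl

end call

end Routine

/-! ### Assignments -/

theorem Polynomial.eval_le_eval (p : Polynomial ℕ) {m n : ℕ} (h : m ≤ n) : p.eval m ≤ p.eval n := by
  rw [Polynomial.eval_eq_sum, Polynomial.eval_eq_sum]
  exact Finset.sum_le_sum fun i _ => Nat.mul_le_mul_left _ (Nat.pow_le_pow_left h i)

namespace Routine

variable {K : Type} [DecidableEq K] {hq : K} {A : Language Bool} {S S' : K → List Bool}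

/-- Copies the tape `a` to the empty tape `b`, with the help of the empty tape `tmp`. -/
def copy (a tmp b : K) : Routine K hq := (moveAll a [tmp]).seq (moveAll tmp [a, b])

theorem runs_copy {a tmp b : K} (h1 : a ≠ tmp) (h2 : b ≠ tmp) (h3 : a ≠ b) (ht : S tmp = [])
    (hb : S b = []) : (copy a tmp b : Routine K hq).Runs A S (2 * (S a).length + 4)
      (Function.update S b (S a)) := by
  have r1 := runs_moveAll (hq := hq) (A := A) (S := S) (a := a) (L := [tmp]) (by simp) (by simp [h1])
  have r2 := runs_moveAll (hq := hq) (A := A) (S := fun k => if k = a then [] else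
    if k ∈ [tmp] then (S a).reverse ++ S k else S k) (a := tmp) (L := [a, b]) (by simp [h3])
    (by simp [h1.symm, h2.symm])
  refine ((runs_seq r1 r2).mono (by simp [h1.symm, ht]; omega)).congr ?_
  funext k
  by_cases hk1 : k = b
  · subst hk1; simp [h2, h1.symm, h3.symm, ht, hb]
  · by_cases hk2 : k = a
    · subst hk2; simp [h1, h1.symm, h3, ht]
    · by_cases hk3 : k = tmp
      · subst hk3; simp [hk1, ht]
      · simp [hk1, hk2, hk3]

/-- Moves the contents of the tape `a` to the empty tape `b`, with the help of the empty tape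
`tmp`. -/
def move (a tmp b : K) : Routine K hq := (moveAll a [tmp]).seq (moveAll tmp [b])

theorem runs_move {a tmp b : K} (h1 : a ≠ tmp) (h2 : b ≠ tmp) (h3 : a ≠ b) (ht : S tmp = [])
    (hb : S b = []) : (move a tmp b : Routine K hq).Runs A S (2 * (S a).length + 4)
      (Function.update (Function.update S a []) b (S a)) := by
  have r1 := runs_moveAll (hq := hq) (A := A) (S := S) (a := a) (L := [tmp]) (by simp) (by simp [h1])
  have r2 := runs_moveAll (hq := hq) (A := A) (S := fun k => if k = a then [] else
    if k ∈ [tmp] then (S a).reverse ++ S k else S k) (a := tmp) (L := [b]) (by simp)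
    (by simp [h2.symm])
  refine ((runs_seq r1 r2).mono (by simp [h1.symm, ht]; omega)).congr ?_
  funext k
  by_cases hk1 : k = b
  · subst hk1; simp [h2, h1.symm, h3.symm, ht, hb]
  · by_cases hk2 : k = a
    · subst hk2; simp [h1, h3]
    · by_cases hk3 : k = tmp
      · subst hk3; simp [hk1, hk2, ht]
      · simp [hk1, hk2, hk3]

theorem runs_clear {a : K} : (moveAll a [] : Routine K hq).Runs A S ((S a).length + 1)
    (Function.update S a []) := by
  refine (runs_moveAll (by simp) (by simp)).congr ?_
  funext k
  by_cases hk : k = a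
  · subst hk; simp
  · simp [hk]

/-- Replaces the string on the tape `a` by the oracle's answer. -/
def ask (a tmp : K) : Routine K hq := (move a tmp hq).seq (queryTo a)

open Classical in
theorem runs_ask {a tmp : K} (h1 : a ≠ tmp) (h2 : hq ≠ tmp) (h3 : a ≠ hq) (ht : S tmp = [])
    (hb : S hq = []) : (ask a tmp : Routine K hq).Runs A S (2 * (S a).length + 8)
      (Function.update S a [decide (S a ∈ A)]) := by
  refine (runs_seq (runs_move h1 h2 h3 ht hb) runs_queryTo).congr ?_
  funext k
  by_cases hk : k = a
  · subst hk; simp [h3]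
  · by_cases hk' : k = hq
    · subst hk'; simp [hk, hb]
    · simp [hk, hk']

/-- Runs the fragments of a list one after another. -/
def seqList : List (Routine K hq) → Routine K hq
  | [] => skip
  | F :: l => F.seq (seqList l)

theorem runs_seqList {ι : Type} {F : ι → Routine K hq} {d : ι → K} {w : ι → List Bool} {B : ℕ}
    (l : List ι) (hl : (l.map d).Nodup) {S S' : K → List Bool}
    (h : ∀ i ∈ l, ∀ S₁, (∀ a ∉ l.map d, S₁ a = S a) → S₁ (d i) = S (d i) →
      (F i).Runs A S₁ B (Function.update S₁ (d i) (w i)))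
    (hS' : ∀ i ∈ l, S' (d i) = w i) (hSS' : ∀ a ∉ l.map d, S' a = S a) :
    (seqList (l.map F)).Runs A S (l.length * (B + 2) + 1) S' := by
  induction l generalizing S with
  | nil =>
    obtain rfl : S' = S := funext fun a => hSS' a (by simp)
    exact runs_skip.mono (by simp)
  | cons i l ih =>
    rw [List.map_cons, List.nodup_cons] at hl
    have hne : ∀ j ∈ l, d j ≠ d i := fun j hj e => hl.1 (e ▸ List.mem_map_of_mem hj)
    refine (runs_seq (h i (by simp) S (fun _ _ => rfl) rfl) (ih hl.2 ?_ ?_ ?_)).mono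
      (by simp [Nat.succ_mul]; omega)
    · intro j hj S₁ h1 h2
      refine h j (by simp [hj]) S₁ (fun a ha => ?_) ?_
      · rw [List.map_cons, List.mem_cons, not_or] at ha
        rw [h1 a ha.2, Function.update_of_ne ha.1]
      · rw [h2, Function.update_of_ne (hne j hj)]
    · exact fun j hj => hS' j (by simp [hj])
    · intro a ha
      by_cases hai : a = d i
      · subst hai; simp [hS' i]
      · rw [Function.update_of_ne hai]
        exact hSS' a (by simpa [hai] using ha)

variable {k : ℕ}

open Classical in
/-- Stores in the tape `dst` the output of the machine `N` on the contents of the tapes `args i`.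
The machine works on the tapes `e i`, its queries are answered by `sub`. -/
def assign (N : OracleTM k) (e : Fin k ⊕ N.W → K) (args : Fin k → K) (tmp dst : K)
    (sub : Routine K hq) : Routine K hq :=
  let _ := Fintype.ofFinite N.W
  (seqList ((List.finRange k).map fun i => copy (args i) tmp (e (.inl i)))).seq <|
    (call N e sub).seq <| (move (e (.inr N.outputTape)) tmp dst).seq <|
      seqList ((Finset.univ : Finset (Fin k ⊕ N.W)).toList.map fun a => moveAll (e a) [])

open Classical in
/-- If `N` works in polynomial time and `sub` answers the queries of `N` in time `B` as the oracle
`O` would do, then the assignment takes at most `B + 1` times polynomially many steps.  The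
polynomial depends on `N` only, which makes it possible to nest assignments. -/
theorem exists_runs_assign (N : OracleTM k) (hN : N.PolyTime) : ∃ P : Polynomial ℕ,
    ∀ {K : Type} [DecidableEq K] {hq : K} {e : Fin k ⊕ N.W → K} {args : Fin k → K} {tmp dst : K}
      {sub : Routine K hq} {A O : Language Bool} {S : K → List Bool} {B : ℕ} {y : List Bool}
      (_ : e.Injective) (_ : tmp ∉ Set.range e) (_ : dst ∉ Set.range e) (_ : dst ≠ tmp)
      (_ : ∀ i, args i ∉ Set.range e) (_ : ∀ i, args i ≠ tmp) (_ : ∀ a, S (e a) = [])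
      (_ : S tmp = []) (_ : S dst = [])
      (_ : ∀ S', (∀ a ∉ Set.range e, S' a = S a) →
        (S' (e (.inr N.queryTape))).length ≤ P.eval (∑ i, (S (args i)).length) →
        sub.Runs A S' B (Function.update S' (e (.inr N.queryTape))
          [decide (S' (e (.inr N.queryTape)) ∈ O)]))
      (_ : N.Outputs O (fun i => S (args i)) y),
      (assign N e args tmp dst sub).Runs A S ((B + 1) * P.eval (∑ i, (S (args i)).length))
        (Function.update S dst y) := by
  let _ := Fintype.ofFinite N.W
  obtain ⟨p, hp⟩ := hN
  obtain ⟨c, hc⟩ := N.toRoutine.exists_length_le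
  let n := Fintype.card (Fin k ⊕ N.W)
  refine ⟨(k : Polynomial ℕ) * (2 * .X + 6) + 2 * p + (n + 2 : Polynomial ℕ) * (.X + c * p + 3) + 20,
    fun {K _ hq e args tmp dst sub A O S B y} he htmp hdst hdt hargs hargt hS hStmp hSdst hsub hout
      => ?_⟩
  set u : Fin k → List Bool := fun i => S (args i) with hu
  have hui : ∀ i, (S (args i)).length ≤ ∑ i, (S (args i)).length := fun i =>
    Finset.single_le_sum (f := fun i => (S (args i)).length) (fun _ _ => Nat.zero_le _)
      (Finset.mem_univ i)
  set s := ∑ i, (S (args i)).length with hs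
  set T := p.eval s with hT
  set P := Polynomial.eval s _ with hP
  have hP' : P = k * (2 * s + 6) + 2 * T + (n + 2) * (s + c * T + 3) + 20 := by
    simp [hP, hT]
  have hlen : ∀ m ≤ T, ∀ a, ((N.run O u m).stk a).length ≤ s + c * T := by
    intro m hm a
    rw [N.run_eq]
    refine (hc O _ m a).trans (Nat.add_le_add ?_ (Nat.mul_le_mul_left c hm))
    obtain i | w := a
    · exact hui i
    · simp [OracleTM.initCfg]
  have hℓ : s + c * T ≤ P := by rw [hP']; nlinarith
  have halt : (N.run O u T).l = none := hp O u
  have hout' : (N.run O u T).stk (.inr N.outputTape) = y := hout.eq_of_run halt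
  -- The arguments have been copied to the input tapes of `N`.
  let S₁ : K → List Bool := fun a => if h : ∃ i, e (.inl i) = a then u h.choose else S a
  have hS₁ : S₁ ∘ e = Sum.elim u fun _ => [] := by
    funext a
    obtain i | w := a
    · have h : ∃ j, e (.inl j) = e (.inl i) := ⟨i, rfl⟩
      have : h.choose = i := by simpa using he h.choose_spec
      simp only [S₁, Function.comp, dif_pos h, this, Sum.elim_inl]
    · have h : ¬ ∃ j, e (.inl j) = e (.inr w) := fun ⟨j, hj⟩ => by simpa using he hj
      simp only [S₁, Function.comp, dif_neg h, hS, Sum.elim_inr]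
  have hSS₁ : ∀ a, (¬ ∃ i, e (.inl i) = a) → S₁ a = S a := fun a ha => dif_neg ha
  have hSS₁' : ∀ a ∉ Set.range e, S₁ a = S a := fun a ha =>
    hSS₁ a fun ⟨i, hi⟩ => ha ⟨_, hi⟩
  have r1 : (seqList ((List.finRange k).map fun i => copy (args i) tmp (e (.inl i))) :
      Routine K hq).Runs A S (k * (2 * s + 6) + 1) S₁ := by
    have := runs_seqList (hq := hq) (A := A) (S := S) (S' := S₁) (B := 2 * s + 4)
      (F := fun i => copy (args i) tmp (e (.inl i))) (d := fun i => e (.inl i)) (w := u)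
      (List.finRange k) ((List.nodup_finRange k).map fun i j hij => by simpa using he hij) ?_
      (fun i _ => congrFun hS₁ (.inl i)) (fun a ha => hSS₁ a (by simpa using ha))
    · simpa using this
    · intro i _ S₂ h1 h2
      have ha : S₂ (args i) = u i := h1 _ fun hm => by
        obtain ⟨j, -, hj⟩ := List.mem_map.1 hm
        exact hargs i ⟨_, hj⟩
      have ht : S₂ tmp = [] := (h1 _ fun hm => by
        obtain ⟨j, -, hj⟩ := List.mem_map.1 hm
        exact htmp ⟨_, hj⟩).trans hStmp
      rw [← ha]
      refine (runs_copy (hargt i) (fun h => htmp ⟨_, h⟩) (fun h => hargs i ⟨_, h.symm⟩) ht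
        (by rw [h2, hS])).mono ?_
      rw [ha]
      have := hui i
      simp only [hu]
      omega
  -- `N` has been run.
  let S₂ : K → List Bool := fun a =>
    if h : ∃ i, e i = a then (N.run O u T).stk h.choose else S a
  have hS₂ : S₂ ∘ e = (N.run O u T).stk := by
    funext a
    have h : ∃ j, e j = e a := ⟨a, rfl⟩
    have : h.choose = a := he h.choose_spec
    simp only [S₂, Function.comp, dif_pos h, this]
  have hSS₂ : ∀ a ∉ Set.range e, S₂ a = S a := fun a ha => dif_neg ha
  have r2 : (call N e sub).Runs A S₁ (T * (B + 2) + 1) S₂ := by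
    refine runs_call he (O := O) (ℓ := s + c * T) (fun S' h1 h2 => ?_) hS₁ halt
      (fun m hm => hlen m hm.le _) hS₂ fun a ha => (hSS₂ a ha).trans (hSS₁' a ha).symm
    exact hsub S' (fun a ha => (h1 a ha).trans (hSS₁' a ha)) (h2.trans hℓ)
  have hS₂out : S₂ (e (.inr N.outputTape)) = y := (congrFun hS₂ _).trans hout'
  have r3 : (move (e (.inr N.outputTape)) tmp dst : Routine K hq).Runs A S₂
      (2 * (s + c * T) + 4)
      (Function.update (Function.update S₂ (e (.inr N.outputTape)) []) dst y) := by
    have := runs_move (hq := hq) (A := A) (S := S₂) (a := e (.inr N.outputTape)) (tmp := tmp)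
      (b := dst) (fun h => htmp ⟨_, h⟩) hdt (fun h => hdst ⟨_, h⟩) (by rw [hSS₂ _ htmp, hStmp])
      (by rw [hSS₂ _ hdst, hSdst])
    rw [hS₂out] at this
    refine this.mono ?_
    have := hlen T le_rfl (.inr N.outputTape)
    rw [hout'] at this
    omega
  -- The tapes of `N` are emptied, for its next use.
  have r4 : (seqList ((Finset.univ : Finset (Fin k ⊕ N.W)).toList.map fun a => moveAll (e a) []) :
      Routine K hq).Runs A
      (Function.update (Function.update S₂ (e (.inr N.outputTape)) []) dst y)
      (n * (s + c * T + 3) + 1) (Function.update S dst y) := by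
    have := runs_seqList (hq := hq) (A := A) (B := s + c * T + 1)
      (S := Function.update (Function.update S₂ (e (.inr N.outputTape)) []) dst y)
      (S' := Function.update S dst y)
      (F := fun i => moveAll (e i) []) (d := e) (w := fun _ => [])
      (Finset.univ : Finset (Fin k ⊕ N.W)).toList ((Finset.nodup_toList _).map he) ?_ ?_ ?_
    · refine this.mono ?_
      rw [Finset.length_toList, Finset.card_univ]
    · intro i _ S₃ _ h2
      refine runs_clear.mono ?_
      have hd : e i ≠ dst := fun h => hdst ⟨_, h⟩
      rw [h2, Function.update_of_ne hd]
      by_cases hi : i = .inr N.outputTape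
      · subst hi; simp
      · rw [Function.update_of_ne (fun h => hi (he h))]
        have := hlen T le_rfl i
        rw [← hS₂] at this
        exact Nat.succ_le_succ this
    · intro i _
      rw [Function.update_of_ne (fun h => hdst ⟨_, h⟩), hS]
    · intro a ha
      have ha' : a ∉ Set.range e := by simpa using ha
      by_cases had : a = dst
      · subst had; simp
      · rw [Function.update_of_ne had, Function.update_of_ne had, Function.update_of_ne,
          hSS₂ a ha']
        rintro rfl; exact ha' ⟨_, rfl⟩
  refine (runs_seq r1 (runs_seq r2 (runs_seq r3 r4))).mono ?_
  rw [hP']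
  generalize k * (2 * s + 6) = x
  have : (n + 2) * (s + c * T + 3) = n * (s + c * T + 3) + 2 * (s + c * T + 3) := by ring
  rw [this]
  generalize n * (s + c * T + 3) = z
  generalize s + c * T = w
  nlinarith [Nat.zero_le (B * (x + z + w)), Nat.zero_le (T * B)]

end Routine

/-! ### Functions computed in polynomial time relative to an oracle -/

/-- The function `f` of an oracle and `k` strings is computed by a polynomial-time oracle machine.
-/
def FP (k : ℕ) (f : Language Bool → (Fin k → List Bool) → List Bool) : Prop :=
  ∃ M : OracleTM k, M.PolyTime ∧ ∀ A u, M.Outputs A u (f A u)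

namespace Routine

variable {K : Type} [DecidableEq K] {k : ℕ}

/-- A fragment as an oracle machine with output tape `out`. -/
abbrev toMachine {W : Type} [DecidableEq W] [Finite W] {hq : W}
    (F : Routine (Fin k ⊕ W) (Sum.inr hq)) (out : W) : OracleTM k where
  W := W
  Λ := F.Λ
  σ := F.σ
  queryTape := hq
  outputTape := out
  main := F.main
  init := F.init
  query := F.query
  prog := F.prog

/-- The assignment `dst := N args`, where `N` has access to the oracle. -/
def assignFP {hq : K} (N : OracleTM k) (e : Fin k ⊕ N.W → K) (args : Fin k → K) (tmp dst : K) :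
    Routine K hq :=
  assign N e args tmp dst (ask (e (.inr N.queryTape)) tmp)

/-- The answer that has been computed on the tape `ans` replaces the query on the tape `a`. -/
theorem runs_answer {hq a ans : K} {A : Language Bool} {S : K → List Bool} {b : Bool}
    (hne : a ≠ ans) (hans : S ans = []) : ((moveAll a []).seq (moveAll ans [a]) : Routine K hq).Runs A
      (Function.update S ans [b]) ((S a).length + 5) (Function.update S a [b]) := by
  refine ((runs_seq runs_clear (runs_moveAll (by simp) (by simp [hne.symm]))).mono ?_).congr ?_
  · simp only [Function.update_of_ne hne, Function.update_of_ne hne.symm, Function.update_self,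
      List.length_singleton]
    omega
  · funext x
    by_cases hx : x = a
    · subst hx
      simp [hne, hne.symm]
    · by_cases hx' : x = ans
      · subst hx'; simp [hx, hans]
      · simp [hx, hx']

end Routine

namespace FP

open Routine

variable {k : ℕ} {f : Language Bool → (Fin k → List Bool) → List Bool}

theorem of_routine {W : Type} [DecidableEq W] [Finite W] {hq : W}
    (F : Routine (Fin k ⊕ W) (Sum.inr hq)) (out : W) (p : Polynomial ℕ)
    (h : ∀ A u, ∃ S', F.Runs A (Sum.elim u fun _ => []) (p.eval (∑ i, (u i).length)) S' ∧
      S' (.inr out) = f A u) : FP k f := by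
  have H : ∀ A u, ((F.toMachine out).run A u (p.eval (∑ i, (u i).length))).l = none ∧
      ((F.toMachine out).run A u (p.eval (∑ i, (u i).length))).stk (.inr out) = f A u := by
    intro A u
    obtain ⟨S', h1, h2⟩ := h A u
    obtain ⟨t, ht, v', h3⟩ := h1 F.init
    have : (F.toMachine out).run A u t = ⟨none, v', S'⟩ := by
      rw [OracleTM.run_eq]; exact h3
    rw [OracleTM.run_of_le _ (by rw [this]) ht, this]
    exact ⟨rfl, h2⟩
  exact ⟨F.toMachine out, ⟨p, fun A u => (H A u).1⟩, fun A u => ⟨_, H A u⟩⟩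

theorem of_polyTime {M : OracleTM k} (hM : M.PolyTime) (h : ∀ A u, M.Outputs A u (f A u)) :
    FP k f := ⟨M, hM, h⟩

/-- The values of a polynomial-time function have polynomial length, uniformly in the oracle. -/
theorem exists_length_le (hf : FP k f) : ∃ P : Polynomial ℕ,
    ∀ A u, (f A u).length ≤ P.eval (∑ i, (u i).length) := by
  obtain ⟨M, ⟨p, hp⟩, hM⟩ := hf
  obtain ⟨c, hc⟩ := M.toRoutine.exists_length_le
  refine ⟨c * p, fun A u => ?_⟩
  rw [← (hM A u).eq_of_run (hp A u), M.run_eq]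
  refine (hc A _ _ _).trans ?_
  simp [OracleTM.initCfg]

/-- Assignments of the values of a polynomial-time function can be carried out by fragments, in
polynomial time. -/
theorem exists_runs_assignFP (hf : FP k f) : ∃ (N : OracleTM k) (P : Polynomial ℕ),
    ∀ {K : Type} [DecidableEq K] {hq : K} {e : Fin k ⊕ N.W → K} {args : Fin k → K} {tmp dst : K}
      {A : Language Bool} {S : K → List Bool} (_ : e.Injective) (_ : tmp ∉ Set.range e)
      (_ : hq ∉ Set.range e) (_ : dst ∉ Set.range e) (_ : dst ≠ tmp) (_ : hq ≠ tmp)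
      (_ : ∀ i, args i ∉ Set.range e) (_ : ∀ i, args i ≠ tmp) (_ : ∀ a, S (e a) = [])
      (_ : S tmp = []) (_ : S dst = []) (_ : S hq = []),
      (assignFP N e args tmp dst : Routine K hq).Runs A S (P.eval (∑ i, (S (args i)).length))
        (Function.update S dst (f A fun i => S (args i))) := by
  classical
  obtain ⟨N, hN, hNf⟩ := hf
  obtain ⟨P, hP⟩ := exists_runs_assign N hN
  refine ⟨N, (2 * P + 9) * P, fun {K _ hq e args tmp dst A S} he htmp hhq hdst hdt hhqt hargs hargt
    hS hStmp hSdst hShq => ?_⟩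
  refine (hP (K := K) (hq := hq) (e := e) (args := args) (tmp := tmp) (dst := dst) (A := A) (S := S)
    (B := 2 * P.eval (∑ i, (S (args i)).length) + 8) (O := A) he htmp hdst hdt hargs hargt hS hStmp
    hSdst (fun S' h1 h2 => ?_) (hNf A _)).mono (by simp; nlinarith)
  refine (runs_ask (fun h => htmp ⟨_, h⟩) hhqt (fun h => hhq ⟨_, h⟩) (by rw [h1 _ htmp, hStmp])
    (by rw [h1 _ hhq, hShq])).mono (by omega) |>.congr (by congr!)

theorem proj (i : Fin k) : FP k fun _ u => u i := by
  refine of_routine (W := Bool) (hq := true) (move (.inl i) (.inr false) (.inr true)) true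
    (2 * .X + 4) fun A u => ⟨_, (runs_move (by simp) (by simp) (by simp) rfl rfl).mono ?_, ?_⟩
  · have := Finset.single_le_sum (f := fun i => (u i).length) (fun _ _ => Nat.zero_le _)
      (Finset.mem_univ i)
    simpa using this
  · simp only [Function.update_self, Sum.elim_inl]

theorem nil : FP k fun _ _ => [] :=
  of_routine (W := Unit) (hq := ()) skip () 1 fun A u => ⟨_, runs_skip.mono (by simp), rfl⟩

theorem cons_aux (b : Bool) : FP 1 fun _ u => b :: u 0 := by
  refine of_routine (W := Bool) (hq := true)
    ((move (.inl 0) (.inr false) (.inr true)).seq (pushBit (.inr true) b)) true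
    (2 * .X + 7) fun A u => ⟨_, (runs_seq (runs_move (by simp) (by simp) (by simp) rfl rfl)
      runs_pushBit).mono ?_, ?_⟩
  · simp only [Polynomial.eval_add, Polynomial.eval_mul, Polynomial.eval_ofNat, Polynomial.eval_X,
      Fin.sum_univ_one, Sum.elim_inl]
    exact le_rfl
  · simp only [Function.update_self, Sum.elim_inl]

theorem tail_aux : FP 1 fun _ u => (u 0).tail := by
  refine of_routine (W := Bool) (hq := true)
    ((move (.inl 0) (.inr false) (.inr true)).seq (popBit (.inr true))) true
    (2 * .X + 7) fun A u => ⟨_, (runs_seq (runs_move (by simp) (by simp) (by simp) rfl rfl)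
      runs_popBit).mono ?_, ?_⟩
  · simp only [Polynomial.eval_add, Polynomial.eval_mul, Polynomial.eval_ofNat, Polynomial.eval_X,
      Fin.sum_univ_one, Sum.elim_inl]
    exact le_rfl
  · simp only [Function.update_self, Sum.elim_inl]

theorem cases_aux : FP 4 fun _ u => (u 0).head?.elim (u 1) fun b => bif b then u 2 else u 3 := by
  refine of_routine (W := Bool) (hq := true)
    (caseTop (.inl 0) fun o => move (.inl (o.elim 1 fun b => bif b then 2 else 3)) (.inr false)
      (.inr true)) true (2 * .X + 7) fun A u => ?_
  have r := runs_move (hq := .inr true) (A := A) (S := Sum.elim u fun _ => [])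
    (a := .inl ((u 0).head?.elim 1 fun b => bif b then 2 else 3)) (tmp := .inr false)
    (b := .inr true) (by simp) (by simp) (by simp) rfl rfl
  refine ⟨_, (runs_caseTop r).mono ?_, ?_⟩
  · have := Finset.single_le_sum (f := fun i => (u i).length) (fun _ _ => Nat.zero_le _)
      (Finset.mem_univ ((u 0).head?.elim 1 fun b => bif b then 2 else 3))
    simp only [Polynomial.eval_add, Polynomial.eval_mul, Polynomial.eval_ofNat, Polynomial.eval_X,
      Sum.elim_inl]
    omega
  · rw [Function.update_self, Sum.elim_inl]
    rcases (u 0).head? with _ | _ | _ <;> rfl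

open Classical in
theorem query_aux : FP 1 fun A u => [decide (u 0 ∈ A)] := by
  refine of_routine (W := Fin 3) (hq := 0)
    ((move (.inl 0) (.inr 1) (.inr 0)).seq (queryTo (.inr 2))) 2
    (2 * .X + 8) fun A u => ⟨_, (runs_seq (runs_move (by simp) (by simp) (by simp) rfl rfl)
      runs_queryTo).mono ?_, ?_⟩
  · simp only [Polynomial.eval_add, Polynomial.eval_mul, Polynomial.eval_ofNat, Polynomial.eval_X,
      Fin.sum_univ_one, Sum.elim_inl]
    exact le_rfl
  · rw [Function.update_self, Function.update_self, Function.update_of_ne (by simp),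
      Function.update_of_ne (by simp), Function.update_of_ne (by simp)]
    rfl

/-- The tapes for a composition: four auxiliary tapes, a tape for each of the intermediate results,
and those of the machines that are called. -/
abbrev CompTapes {j : ℕ} (Ng : Fin j → OracleTM k) (Nf : OracleTM j) : Type :=
  Fin 4 ⊕ (Fin j ⊕ ((Σ i : Fin j, Fin k ⊕ (Ng i).W) ⊕ (Fin j ⊕ Nf.W)))

set_option synthInstance.maxSize 1000 in
/-- Polynomial-time functions are closed under composition. -/
theorem comp {j : ℕ} {f : Language Bool → (Fin j → List Bool) → List Bool} (hf : FP j f)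
    {g : Fin j → Language Bool → (Fin k → List Bool) → List Bool} (hg : ∀ i, FP k (g i)) :
    FP k fun A u => f A fun i => g i A u := by
  obtain ⟨Nf, Pf, hPf⟩ := hf.exists_runs_assignFP
  choose Q hQ using fun i => (hg i).exists_length_le
  choose N P hP using fun i => (hg i).exists_runs_assignFP
  let hq : CompTapes N Nf := .inl 0
  let tmp : Fin k ⊕ CompTapes N Nf := .inr (.inl 1)
  let v : Fin j → Fin k ⊕ CompTapes N Nf := fun i => .inr (.inr (.inl i))
  let F₁ : Fin j → Routine (Fin k ⊕ CompTapes N Nf) (.inr hq) := fun i =>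
    assignFP (N i) (fun a => .inr (.inr (.inr (.inl ⟨i, a⟩)))) Sum.inl tmp (v i)
  let F₂ : Routine (Fin k ⊕ CompTapes N Nf) (.inr hq) :=
    assignFP Nf (fun a => .inr (.inr (.inr (.inr a)))) v tmp (.inr (.inl 2))
  refine of_routine (W := CompTapes N Nf) (hq := hq) ((seqList ((List.finRange j).map F₁)).seq F₂) (.inl 2)
    ((j : Polynomial ℕ) * ((∑ i, P i) + 2) + 1 + Pf.comp (∑ i, Q i) + 2) fun A u => ?_
  -- The intermediate results have been computed.
  let S₁ : Fin k ⊕ CompTapes N Nf → List Bool :=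
    Sum.elim u (Sum.elim (fun _ => []) (Sum.elim (fun i => g i A u) fun _ => []))
  have r1 : (seqList ((List.finRange j).map F₁)).Runs A (Sum.elim u fun _ => [])
      (j * ((∑ i, P i).eval (∑ i, (u i).length) + 2) + 1) S₁ := by
    have := runs_seqList (A := A) (F := F₁) (d := v) (w := fun i => g i A u)
      (S := Sum.elim u fun _ => []) (S' := S₁) (B := (∑ i, P i).eval (∑ i, (u i).length))
      (List.finRange j) ((List.nodup_finRange j).map fun a b h => by simpa [v] using h) ?_
      (fun i _ => rfl) ?_
    · simpa using this
    · intro i _ S h1 h2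
      have hSu : ∀ i, S (.inl i) = u i := fun i => h1 _ (by simp [v])
      have hSi : (fun i => S (.inl i)) = u := funext hSu
      have := hP i (K := Fin k ⊕ CompTapes N Nf) (hq := .inr hq) (A := A) (S := S)
        (e := fun a => .inr (.inr (.inr (.inl ⟨i, a⟩)))) (args := Sum.inl) (tmp := tmp) (dst := v i)
        (fun a b h => by simpa using h) (by simp [tmp]) (by simp [hq]) (by simp [v])
        (by simp [v, tmp]) (by simp [tmp, hq]) (by simp) (by simp [tmp])
        (fun a => h1 _ (by simp [v])) (h1 _ (by simp [v, tmp])) h2 (h1 _ (by simp [v, hq]))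
      rw [hSi] at this
      refine this.mono ?_
      simp only [hSu, Polynomial.eval_finsetSum]
      exact Finset.single_le_sum (f := fun l => (P l).eval (∑ i, (u i).length))
        (fun _ _ => Nat.zero_le _) (Finset.mem_univ i)
    · rintro (a | a | a | a) ha
      · rfl
      · rfl
      · exact absurd ha (by simp [v])
      · rfl
  have r2 := hPf (K := Fin k ⊕ CompTapes N Nf) (hq := .inr hq) (A := A) (S := S₁)
    (e := fun a => .inr (.inr (.inr (.inr a)))) (args := v) (tmp := tmp) (dst := .inr (.inl 2))
    (fun a b h => by simpa using h) (by simp [tmp]) (by simp [hq]) (by simp)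
    (by simp [tmp]) (by simp [tmp, hq]) (by simp [v]) (by simp [tmp, v])
    (fun a => rfl) rfl rfl rfl
  refine ⟨_, (runs_seq r1 r2).mono ?_, by rw [Function.update_self]; rfl⟩
  have : Pf.eval (∑ i, (g i A u).length) ≤
      Pf.eval (∑ i, (Q i).eval (∑ i, (u i).length)) :=
    Pf.eval_le_eval (Finset.sum_le_sum fun i _ => hQ i A u)
  simp only [Polynomial.eval_add, Polynomial.eval_mul, Polynomial.eval_comp,
    Polynomial.eval_finsetSum, Polynomial.eval_natCast, Polynomial.eval_ofNat,
    Polynomial.eval_one] at this ⊢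
  exact Nat.add_le_add_right (Nat.add_le_add_left this _) _

/-- The tapes for the substitution of a computation for the oracle: four auxiliary tapes, and those
of the machines that are called. -/
abbrev SubstTapes {j : ℕ} (Nf : OracleTM k) (Ng : OracleTM j) : Type :=
  Fin 4 ⊕ ((Fin k ⊕ Nf.W) ⊕ (Fin j ⊕ Ng.W))

/-- Substituting a polynomial-time computation for the oracle: `f` is run with the oracle whose
answer to the query `q` is the bit `g A (q, u)`. -/
theorem subst {j : ℕ} {f : Language Bool → (Fin k → List Bool) → List Bool} (hf : FP k f)
    {g : Language Bool → (Fin (j + 1) → List Bool) → List Bool} (hg : FP (j + 1) g)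
    (hg1 : ∀ A u, ∃ b, g A u = [b]) (a : Fin k → Fin j) :
    FP j fun A u => f {q | g A (Fin.cons q u) = [true]} fun i => u (a i) := by
  obtain ⟨Nf, hNf, hf⟩ := hf
  obtain ⟨P, hP⟩ := exists_runs_assign Nf hNf
  obtain ⟨Ng, Q, hQ⟩ := hg.exists_runs_assignFP
  let hq : SubstTapes Nf Ng := .inl 0
  let tmp : Fin j ⊕ SubstTapes Nf Ng := .inr (.inl 1)
  let ans : Fin j ⊕ SubstTapes Nf Ng := .inr (.inl 3)
  let ef : Fin k ⊕ Nf.W → Fin j ⊕ SubstTapes Nf Ng := fun a => .inr (.inr (.inl a))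
  let sq := ef (.inr Nf.queryTape)
  let sub : Routine (Fin j ⊕ SubstTapes Nf Ng) (.inr hq) :=
    (assignFP Ng (fun a => .inr (.inr (.inr a))) (Fin.cons sq Sum.inl) tmp ans).seq <|
      (moveAll sq []).seq (moveAll ans [sq])
  refine of_routine (W := SubstTapes Nf Ng) (hq := hq)
    (assign Nf ef (fun i => .inl (a i)) tmp (.inr (.inl 2)) sub) (.inl 2)
    ((Q.comp (P.comp (k * .X) + .X) + P.comp (k * .X) + 10) * P.comp (k * .X)) fun A u => ?_
  set s := ∑ i, (u (a i)).length with hs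
  have hsle : s ≤ k * ∑ i, (u i).length := by
    refine (Finset.sum_le_card_nsmul Finset.univ _ (∑ i, (u i).length) fun i _ => ?_).trans
      (by simp)
    exact Finset.single_le_sum (f := fun i => (u i).length) (fun _ _ => Nat.zero_le _)
      (Finset.mem_univ (a i))
  refine ⟨_, (hP (K := Fin j ⊕ SubstTapes Nf Ng) (hq := .inr hq) (e := ef) (args := fun i => .inl (a i))
    (tmp := tmp) (dst := .inr (.inl 2)) (sub := sub) (A := A)
    (S := Sum.elim u fun _ => []) (O := {q | g A (Fin.cons q u) = [true]})
    (B := Q.eval (P.eval s + ∑ i, (u i).length) + P.eval s + 9)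
    (fun a b h => by simpa [ef] using h) (by simp [tmp, ef]) (by simp [ef])
    (by simp [tmp]) (by simp [ef]) (by simp [tmp]) (fun a => rfl) rfl rfl (fun S h1 h2 => ?_)
    (hf _ _)).mono ?_, by rw [Function.update_self]; rfl⟩
  · have hSu : ∀ i, S (.inl i) = u i := fun i => h1 _ (by simp [ef])
    have hargs : (fun i => S ((Fin.cons sq Sum.inl : Fin (j + 1) → Fin j ⊕ SubstTapes Nf Ng) i)) =
        Fin.cons (S sq) u := by
      funext i
      refine Fin.cases rfl (fun i => ?_) i
      simp [hSu]
    have hans : S ans = [] := h1 _ (by simp [ef, ans])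
    have r1 := hQ (K := Fin j ⊕ SubstTapes Nf Ng) (hq := .inr hq) (A := A) (S := S)
      (e := fun a => .inr (.inr (.inr a))) (args := Fin.cons sq Sum.inl) (tmp := tmp) (dst := ans)
      (fun a b h => by simpa using h) (by simp [tmp]) (by simp [hq]) (by simp [ans])
      (by simp [tmp, ans]) (by simp [tmp, hq]) (fun i => by
        refine Fin.cases (by simp [sq, ef]) (fun i => by simp) i)
      (fun i => by refine Fin.cases (by simp [sq, ef, tmp]) (fun i => by simp [tmp]) i)
      (fun a => h1 _ (by simp [ef])) (h1 _ (by simp [ef, tmp])) hans (h1 _ (by simp [ef, hq]))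
    obtain ⟨b, hb⟩ := hg1 A (Fin.cons (S sq) u)
    rw [hargs, hb] at r1
    have hne : sq ≠ ans := by simp [sq, ans, ef]
    refine ((runs_seq r1 (runs_answer hne hans)).mono ?_).congr ?_
    · have : ∑ i, (S ((Fin.cons sq Sum.inl : Fin (j + 1) → Fin j ⊕ SubstTapes Nf Ng) i)).length ≤
          P.eval s + ∑ i, (u i).length := by
        rw [Fin.sum_univ_succ]
        simp only [Fin.cons_zero, Fin.cons_succ, hSu]
        exact Nat.add_le_add_right h2 _
      have := Q.eval_le_eval this
      have h2' : (S sq).length ≤ P.eval s := h2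
      omega
    · have hb' : b = true ↔ g A (Fin.cons (S sq) u) = [true] := by rw [hb]; simp
      exact congrArg (fun c => Function.update S sq [c])
        (Bool.eq_iff_iff.2 (hb'.trans (@decide_eq_true_iff _ (Classical.propDecidable _)).symm))
  · have h3 : P.eval s ≤ P.eval (k * ∑ i, (u i).length) := P.eval_le_eval hsle
    have h4 : Q.eval (P.eval s + ∑ i, (u i).length) ≤
        Q.eval (P.eval (k * ∑ i, (u i).length) + ∑ i, (u i).length) :=
      Q.eval_le_eval (Nat.add_le_add_right h3 _)
    simp only [Polynomial.eval_add, Polynomial.eval_mul, Polynomial.eval_comp,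
      Polynomial.eval_natCast, Polynomial.eval_ofNat, Polynomial.eval_X, Nat.cast_id]
    exact Nat.mul_le_mul (by omega) h3

end FP

/-! ### Recursion on strings -/

/-- Recursion on strings: the step function is given the current string and the value at its tail.
-/
def strRec (s : List Bool) (g : List Bool → List Bool → List Bool) : List Bool → List Bool
  | [] => s
  | b :: l => g (b :: l) (strRec s g l)

namespace FP

open Routine

variable {k : ℕ}

/-- The tapes for a recursion: six auxiliary tapes (for queries and for moving strings, the part of
the string that is still to be processed, the processed part, the current and the next value), and
those of the machine for the step function. -/
abbrev RecTapes (N : OracleTM (k + 2)) : Type := Fin 6 ⊕ (Fin (k + 2) ⊕ N.W)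

/-- The tape contents during a recursion: `p` on the input tapes, `V` on the auxiliary tapes. -/
def recState (N : OracleTM (k + 2)) (p : Fin (k + 2) → List Bool) (V : Fin 6 → List Bool) :
    Fin (k + 2) ⊕ RecTapes N → List Bool :=
  Sum.elim p (Sum.elim V fun _ => [])

theorem update_recState (N : OracleTM (k + 2)) (p : Fin (k + 2) → List Bool) (V : Fin 6 → List Bool)
    (i : Fin 6) (x : List Bool) : Function.update (recState N p V) (.inr (.inl i)) x =
      recState N p (Function.update V i x) := by
  rw [recState, Sum.update_elim_inr, Sum.update_elim_inl, recState]

/-- The case of `FP.strRec` in which the string and the initial value are inputs.  The string is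
processed from its end, one symbol per round of a loop; a polynomial bound on the values that occur
is needed, since each of them is an input for the next round. -/
theorem rec_aux {g : Language Bool → (Fin (k + 2) → List Bool) → List Bool} (hg : FP (k + 2) g)
    {B : Polynomial ℕ} (hB : ∀ A u s l, (strRec s (fun c r => g A (Fin.cons c (Fin.cons r u)))
      l).length ≤ B.eval (l.length + (s.length + ∑ i, (u i).length))) :
    FP (k + 2) fun A w => strRec (w 1)
      (fun c r => g A (Fin.cons c (Fin.cons r fun i => w i.succ.succ))) (w 0) := by
  obtain ⟨N, P, hP⟩ := hg.exists_runs_assignFP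
  let hq : RecTapes N := .inl 0
  let aux : Fin 6 → Fin (k + 2) ⊕ RecTapes N := fun i => .inr (.inl i)
  let args : Fin (k + 2) → Fin (k + 2) ⊕ RecTapes N :=
    Fin.cons (aux 3) (Fin.cons (aux 4) fun i => .inl i.succ.succ)
  let body : Routine (Fin (k + 2) ⊕ RecTapes N) (.inr hq) :=
    (moveOne (aux 2) (aux 3)).seq <|
      (assignFP N (fun a => .inr (.inr a)) args (aux 1) (aux 5)).seq <|
        (moveAll (aux 4) []).seq (move (aux 5) (aux 1) (aux 4))
  refine of_routine (W := RecTapes N) (hq := hq)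
    ((moveAll (.inl 0) [aux 2]).seq ((move (.inl 1) (aux 1) (aux 4)).seq (loop (aux 2) body))) (.inl 4)
    (.X + 1 + (2 * .X + 4 + (.X * (1 + (P.comp (.X + B + .X) + (B + 1 + (2 * B + 4) + 2) + 2) + 2
      + 3) + 2) + 2) + 2) ?_
  intro A w
  set s := ∑ i, (w i).length with hs
  set u : Fin k → List Bool := fun i => w i.succ.succ with hu
  have hsum : s = (w 0).length + ((w 1).length + ∑ i, (u i).length) := by
    rw [hs, Fin.sum_univ_succ, Fin.sum_univ_succ]; rfl
  set f : List Bool → List Bool := strRec (w 1) (fun c r => g A (Fin.cons c (Fin.cons r u))) with hf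
  have hfB : ∀ l : List Bool, l.length ≤ (w 0).length → (f l).length ≤ B.eval s := fun l hl =>
    (hB A u (w 1) l).trans (B.eval_le_eval (by omega))
  let p : Fin (k + 2) → List Bool := Fin.cons [] (Fin.cons [] u)
  have hbody : ∀ (x : Bool) (rem cur : List Bool), cur.length < (w 0).length →
      body.Runs A (recState N p ![[], [], x :: rem, cur, f cur, []])
        (1 + (P.eval (s + B.eval s + s) + (B.eval s + 1 + (2 * B.eval s + 4) + 2) + 2) + 2)
        (recState N p ![[], [], rem, x :: cur, f (x :: cur), []]) := by
    intro x rem cur hcur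
    have r1 : (moveOne (aux 2) (aux 3) : Routine _ (.inr hq)).Runs A
        (recState N p ![[], [], x :: rem, cur, f cur, []]) 1
        (recState N p ![[], [], rem, x :: cur, f cur, []]) := by
      refine (runs_moveOne (a := aux 2) (b := aux 3) (c := x) (l := rem) (by simp [aux])
        rfl).congr ?_
      rw [update_recState, update_recState]
      congr 1
      funext i; fin_cases i <;> rfl
    have hargs : (fun i => recState N p ![[], [], rem, x :: cur, f cur, []] (args i)) =
        Fin.cons (x :: cur) (Fin.cons (f cur) u) := by
      funext i
      refine Fin.cases rfl (fun i => Fin.cases rfl (fun i => rfl) i) i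
    have r2 := hP (K := Fin (k + 2) ⊕ RecTapes N) (hq := .inr hq) (A := A)
      (S := recState N p ![[], [], rem, x :: cur, f cur, []])
      (e := fun a => .inr (.inr a)) (args := args) (tmp := aux 1) (dst := aux 5)
      (fun a b h => by simpa using h) (by simp [aux]) (by simp [hq]) (by simp [aux])
      (by simp [aux]) (by simp [aux, hq])
      (fun i => Fin.cases (by simp [args, aux]) (fun i => Fin.cases (by simp [args, aux])
        (fun i => by simp [args]) i) i)
      (fun i => Fin.cases (by simp [args, aux]) (fun i => Fin.cases (by simp [args, aux])
        (fun i => by simp [args, aux]) i) i)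
      (fun a => rfl) rfl rfl rfl
    rw [hargs, update_recState] at r2
    have hv : Function.update ![[], [], rem, x :: cur, f cur, []] 5
        (g A (Fin.cons (x :: cur) (Fin.cons (f cur) u))) =
        (![[], [], rem, x :: cur, f cur, f (x :: cur)] : Fin 6 → List Bool) := by
      funext i; fin_cases i <;> rfl
    rw [hv] at r2
    have r3 : (moveAll (aux 4) [] : Routine _ (.inr hq)).Runs A
        (recState N p ![[], [], rem, x :: cur, f cur, f (x :: cur)]) (B.eval s + 1)
        (recState N p ![[], [], rem, x :: cur, [], f (x :: cur)]) := by
      refine ((runs_clear (a := aux 4)).mono (Nat.succ_le_succ (hfB cur hcur.le))).congr ?_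
      rw [update_recState]
      congr 1
      funext i; fin_cases i <;> rfl
    have r4 : (move (aux 5) (aux 1) (aux 4) : Routine _ (.inr hq)).Runs A
        (recState N p ![[], [], rem, x :: cur, [], f (x :: cur)]) (2 * B.eval s + 4)
        (recState N p ![[], [], rem, x :: cur, f (x :: cur), []]) := by
      refine ((runs_move (a := aux 5) (tmp := aux 1) (b := aux 4) (by simp [aux]) (by simp [aux])
        (by simp [aux]) rfl rfl).mono (Nat.add_le_add_right (Nat.mul_le_mul_left 2 (hfB (x :: cur) hcur)) 4)).congr ?_
      rw [update_recState, update_recState]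
      congr 1
      funext i; fin_cases i <;> rfl
    refine runs_seq r1 (runs_seq (r2.mono (P.eval_le_eval ?_)) (runs_seq r3 r4))
    have e1 : ∀ i, (recState N p ![[], [], rem, x :: cur, f cur, []] (args i)).length =
        ((Fin.cons (x :: cur) (Fin.cons (f cur) u) : Fin (k + 2) → List Bool) i).length :=
      fun i => congrArg List.length (congrFun hargs i)
    simp only [e1]
    rw [Fin.sum_univ_succ, Fin.sum_univ_succ]
    simp only [Fin.cons_zero, Fin.cons_succ, List.length_cons]
    have := hfB cur hcur.le
    omega
  -- After `n` rounds the last `n` symbols have been processed.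
  let St : ℕ → Fin (k + 2) ⊕ RecTapes N → List Bool := fun n =>
    recState N p ![[], [], ((w 0).take ((w 0).length - n)).reverse, (w 0).drop ((w 0).length - n),
      f ((w 0).drop ((w 0).length - n)), []]
  have rloop := runs_loop (k := aux 2) (F := body) (A := A) (w 0).length St
    (T := 1 + (P.eval (s + B.eval s + s) + (B.eval s + 1 + (2 * B.eval s + 4) + 2) + 2) + 2)
    (fun n hn => by
      have : ((w 0).take ((w 0).length - n)).reverse ≠ [] := by
        rw [Ne, List.reverse_eq_nil_iff, List.take_eq_nil_iff]
        rintro (h | h)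
        · omega
        · simp [h] at hn
      exact this)
    (by
      have : ((w 0).take ((w 0).length - (w 0).length)).reverse = [] := by simp
      exact this)
    (fun n hn => by
      obtain ⟨m, hm⟩ : ∃ m, (w 0).length - n = m + 1 := ⟨(w 0).length - n - 1, by omega⟩
      have hm' : (w 0).length - (n + 1) = m := by omega
      have hlt : m < (w 0).length := by omega
      simp only [St, hm, hm']
      rw [List.take_succ_eq_append_getElem hlt, List.reverse_append, List.reverse_singleton,
        List.singleton_append, List.drop_eq_getElem_cons hlt]
      exact hbody _ _ _ (by rw [List.length_drop]; omega))
  have r1 : (moveAll (.inl 0) [aux 2] : Routine _ (.inr hq)).Runs A (Sum.elim w fun _ => [])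
      (s + 1) (recState N (Fin.cons [] fun i => w i.succ) ![[], [], (w 0).reverse, [], [], []]) := by
    refine ((runs_moveAll (by simp) (by simp [aux])).mono ?_).congr ?_
    · simp only [Sum.elim_inl]; omega
    · funext a
      obtain a | a | a := a
      · refine Fin.cases ?_ (fun a => ?_) a
        · simp [recState]
        · simp [recState, aux]
      · fin_cases a <;> simp [recState, aux]
      · simp [recState, aux]
  have r2 : (move (.inl 1) (aux 1) (aux 4) : Routine _ (.inr hq)).Runs A
      (recState N (Fin.cons [] fun i => w i.succ) ![[], [], (w 0).reverse, [], [], []])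
      (2 * s + 4) (St 0) := by
    refine ((runs_move (S := recState N (Fin.cons [] fun i => w i.succ)
      ![[], [], (w 0).reverse, [], [], []]) (a := .inl 1) (tmp := aux 1) (b := aux 4) (by simp [aux]) (by simp [aux])
      (by simp [aux]) rfl rfl).mono ?_).congr ?_
    · have : recState N (Fin.cons [] fun i => w i.succ) ![[], [], (w 0).reverse, [], [], []]
        (.inl 1) = w 1 := rfl
      rw [this]
      omega
    · rw [show St 0 = recState N p ![[], [], (w 0).reverse, [], w 1, []] by
        simp only [St, Nat.sub_zero, List.take_length, List.drop_length]; rfl]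
      funext a
      obtain a | a | a := a
      · refine Fin.cases rfl (fun a => Fin.cases ?_ (fun a => ?_) a) a
        · rw [Function.update_of_ne (by simp [aux])]
          exact Function.update_self ..
        · rw [Function.update_of_ne (by simp [aux]), Function.update_of_ne
            fun h => absurd (congrArg Fin.val (Sum.inl.inj h)) (by simp)]
          rfl
      · fin_cases a <;> rfl
      · rfl
  refine ⟨_, (runs_seq r1 (runs_seq r2 rloop)).mono ?_, ?_⟩
  · have : (w 0).length ≤ s := by omega
    have := Nat.mul_le_mul_right (1 + (P.eval (s + B.eval s + s) + (B.eval s + 1 +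
      (2 * B.eval s + 4) + 2) + 2) + 2 + 3) this
    simp only [Polynomial.eval_add, Polynomial.eval_mul, Polynomial.eval_comp,
      Polynomial.eval_ofNat, Polynomial.eval_X, Polynomial.eval_one]
    omega
  · change f ((w 0).drop ((w 0).length - (w 0).length)) = f (w 0)
    rw [Nat.sub_self, List.drop_zero]

/-- Recursion on strings, provided that the values are of polynomial length. -/
theorem strRec {b ℓ : Language Bool → (Fin k → List Bool) → List Bool} (hb : FP k b) (hℓ : FP k ℓ)
    {g : Language Bool → (Fin (k + 2) → List Bool) → List Bool} (hg : FP (k + 2) g)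
    (B : Polynomial ℕ) (hB : ∀ A u s l, (_root_.strRec s (fun c r => g A (Fin.cons c
      (Fin.cons r u))) l).length ≤ B.eval (l.length + (s.length + ∑ i, (u i).length))) :
    FP k fun A u => _root_.strRec (b A u) (fun c r => g A (Fin.cons c (Fin.cons r u))) (ℓ A u) := by
  refine (rec_aux hg hB).comp (g := Fin.cons ℓ (Fin.cons b fun i _ u => u i)) fun i => ?_
  refine Fin.cases hℓ (fun i => Fin.cases hb (fun i => proj i) i) i

end FP

/-! ### A library of polynomial-time functions -/

theorem length_strRec_le {s : List Bool} {g : List Bool → List Bool → List Bool} {D : ℕ}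
    (h : ∀ c r, (g c r).length ≤ r.length + D) (l : List Bool) :
    (strRec s g l).length ≤ s.length + l.length * D := by
  induction l with
  | nil => simp [strRec]
  | cons b l ih =>
    refine (h _ _).trans ?_
    rw [List.length_cons, Nat.succ_mul]
    omega

/-- The number `n` in unary notation. -/
abbrev unary (n : ℕ) : List Bool := List.replicate n true

theorem unary_append (m n : ℕ) : unary m ++ unary n = unary (m + n) :=
  List.replicate_append_replicate

/-- The truth value of "the first symbol of `l` is `true`", as a string of one bit. -/
def firstBit (l : List Bool) : List Bool := l.head?.elim [false] fun b => [b]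

theorem firstBit_eq (l : List Bool) : ∃ b, firstBit l = [b] := by
  cases l with
  | nil => exact ⟨false, rfl⟩
  | cons b l => exact ⟨b, rfl⟩

/-- The successor function of the bijective base-two numeration, which lists all strings. -/
def strSucc : List Bool → List Bool
  | [] => [false]
  | false :: l => true :: l
  | true :: l => false :: strSucc l

/-- The `n`-th string. -/
def nthStr (n : ℕ) : List Bool := strSucc^[n] []

/-- One step of majority voting: the stack `r`, whose symbols are all equal, receives the vote `v`;
opposite votes cancel. -/
def castVote (v r : List Bool) : List Bool :=
  r.head?.elim v fun b =>
    bif b then v.head?.elim r fun c => bif c then true :: r else r.tail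
    else v.head?.elim r fun c => bif c then r.tail else false :: r

namespace FP

variable {k : ℕ} {g₀ g₁ g₂ g₃ : Language Bool → (Fin k → List Bool) → List Bool}
  {m n : Language Bool → (Fin k → List Bool) → ℕ}

theorem comp1 {f : Language Bool → List Bool → List Bool} (hf : FP 1 fun A w => f A (w 0))
    (h₀ : FP k g₀) : FP k fun A u => f A (g₀ A u) :=
  hf.comp (g := fun _ => g₀) fun _ => h₀

theorem comp2 {f : Language Bool → List Bool → List Bool → List Bool}
    (hf : FP 2 fun A w => f A (w 0) (w 1)) (h₀ : FP k g₀) (h₁ : FP k g₁) :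
    FP k fun A u => f A (g₀ A u) (g₁ A u) :=
  hf.comp (g := ![g₀, g₁]) fun i => by fin_cases i; exacts [h₀, h₁]

theorem comp3 {f : Language Bool → List Bool → List Bool → List Bool → List Bool}
    (hf : FP 3 fun A w => f A (w 0) (w 1) (w 2)) (h₀ : FP k g₀) (h₁ : FP k g₁) (h₂ : FP k g₂) :
    FP k fun A u => f A (g₀ A u) (g₁ A u) (g₂ A u) :=
  hf.comp (g := ![g₀, g₁, g₂]) fun i => by fin_cases i; exacts [h₀, h₁, h₂]

theorem cons (b : Bool) (h₀ : FP k g₀) : FP k fun A u => b :: g₀ A u :=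
  (cons_aux b).comp1 (f := fun _ x => b :: x) h₀

theorem tail (h₀ : FP k g₀) : FP k fun A u => (g₀ A u).tail :=
  tail_aux.comp1 (f := fun _ x => x.tail) h₀

theorem query (h₀ : FP k g₀) : FP k fun A u => charBit A (g₀ A u) :=
  query_aux.comp1 (f := fun A x => charBit A x) h₀

theorem cases (h₀ : FP k g₀) (h₁ : FP k g₁) (h₂ : FP k g₂) (h₃ : FP k g₃) :
    FP k fun A u => (g₀ A u).head?.elim (g₁ A u) fun b => bif b then g₂ A u else g₃ A u :=
  cases_aux.comp (g := ![g₀, g₁, g₂, g₃]) fun i => by fin_cases i; exacts [h₀, h₁, h₂, h₃]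

theorem const (l : List Bool) : FP k fun _ _ => l := by
  induction l with
  | nil => exact nil
  | cons b l ih => exact ih.cons b

/-- Recursion on strings with an explicitly given step function, each step of which adds only
polynomially many symbols. -/
theorem recursion {b ℓ : Language Bool → (Fin k → List Bool) → List Bool} (hb : FP k b)
    (hℓ : FP k ℓ) {g : Language Bool → List Bool → List Bool → (Fin k → List Bool) → List Bool}
    (hg : FP (k + 2) fun A w => g A (w 0) (w 1) fun i => w i.succ.succ) (D : Polynomial ℕ)
    (hD : ∀ A c r u, (g A c r u).length ≤ r.length + D.eval (∑ i, (u i).length)) :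
    FP k fun A u => _root_.strRec (b A u) (fun c r => g A c r u) (ℓ A u) := by
  refine FP.strRec hb hℓ hg (.X + .X * D) fun A u s l => ?_
  refine (length_strRec_le (fun c r => hD A c r u) l).trans ?_
  have := D.eval_le_eval (show ∑ i, (u i).length ≤ l.length + (s.length + ∑ i, (u i).length)
    by omega)
  have := Nat.mul_le_mul (show l.length ≤ l.length + (s.length + ∑ i, (u i).length) by omega) this
  simp only [Polynomial.eval_add, Polynomial.eval_mul, Polynomial.eval_X]
  omega

theorem firstBit (h₀ : FP k g₀) : FP k fun A u => _root_.firstBit (g₀ A u) := by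
  have := h₀.cases (const [false]) (const [true]) (const [false])
  refine (congrArg (FP k) ?_).mp this
  funext A u
  rw [_root_.firstBit]
  rcases (g₀ A u).head? with _ | _ | _ <;> rfl

theorem length (h₀ : FP k g₀) : FP k fun A u => unary (g₀ A u).length := by
  have := recursion (g := fun _ _ r _ => true :: r) nil h₀ ((proj 1).cons true) 1 (by simp)
  refine (congrArg (FP k) ?_).mp this
  funext A u
  induction g₀ A u with
  | nil => rfl
  | cons b l ih => rw [_root_.strRec, ih, List.length_cons]; rfl

theorem append_unary (h₀ : FP k g₀) (hn : FP k fun A u => unary (n A u)) :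
    FP k fun A u => unary (n A u) ++ g₀ A u := by
  have := recursion (g := fun _ _ r _ => true :: r) h₀ hn ((proj 1).cons true) 1 (by simp)
  refine (congrArg (FP k) ?_).mp this
  funext A u
  induction n A u with
  | zero => rfl
  | succ n ih => rw [unary, List.replicate_succ, _root_.strRec, ih]; rfl

theorem mul (hm : FP k fun A u => unary (m A u)) (hn : FP k fun A u => unary (n A u)) :
    FP k fun A u => unary (m A u * n A u) := by
  have : FP 2 fun _ w => unary ((w 0).length * (w 1).length) := by
    have := recursion (k := 2) (g := fun _ _ r u => unary (u 1).length ++ r) nil (proj 0)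
      ((proj 1).append_unary (proj 3).length) .X (fun A c r u => by simp; omega)
    refine (congrArg (FP 2) ?_).mp this
    funext A u
    induction u 0 with
    | nil => simp [_root_.strRec]
    | cons b l ih =>
      rw [_root_.strRec, ih, List.length_cons, Nat.succ_mul, Nat.add_comm, unary_append]
  have := this.comp2 (f := fun _ x y => unary (x.length * y.length)) hm hn
  simpa only [List.length_replicate] using this

theorem polynomial (p : Polynomial ℕ) (hn : FP k fun A u => unary (n A u)) :
    FP k fun A u => unary (p.eval (n A u)) := by
  induction p using Polynomial.induction_on with
  | C a => simpa using const (unary a)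
  | add p q hp hq => simpa only [Polynomial.eval_add, unary_append] using hq.append_unary hp
  | monomial d a h =>
    refine (congrArg (FP k) ?_).mp (h.mul hn)
    funext A u
    rw [pow_succ, ← mul_assoc]
    simp

theorem drop (hn : FP k fun A u => unary (n A u)) (h₀ : FP k g₀) :
    FP k fun A u => (g₀ A u).drop (n A u) := by
  have := recursion (g := fun _ _ r _ => r.tail) h₀ hn (proj 1).tail 0 (by simp)
  refine (congrArg (FP k) ?_).mp this
  funext A u
  induction n A u with
  | zero => rfl
  | succ n ih => rw [unary, List.replicate_succ, _root_.strRec, ih, List.tail_drop]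

/-- Taking symbols one by one reverses their order; `FP.take` does this twice. -/
theorem reverse_take (hn : FP k fun A u => unary (n A u)) (h₀ : FP k g₀) :
    FP k fun A u => ((g₀ A u).take (n A u)).reverse := by
  have : FP 2 fun _ w => ((w 1).take (w 0).length).reverse := by
    have := recursion (k := 2)
      (g := fun _ c r u => ((u 1).drop c.tail.length).head?.elim r fun b =>
        bif b then true :: r else false :: r) nil (proj 0)
      (((proj 0).tail.length.drop (proj 3)).cases (proj 1) ((proj 1).cons true)
        ((proj 1).cons false)) 1
      (fun A c r u => by rcases ((u 1).drop c.tail.length).head? with _ | _ | _ <;> simp)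
    refine (congrArg (FP 2) ?_).mp this
    funext A u
    induction u 0 with
    | nil => rfl
    | cons b l ih =>
      rw [_root_.strRec, ih, List.length_cons, List.tail_cons, List.take_add_one,
        List.head?_drop, List.reverse_append]
      rcases (u 1)[l.length]? with _ | _ | _ <;> rfl
  have := this.comp2 (f := fun _ x y => (y.take x.length).reverse) hn h₀
  simpa only [List.length_replicate] using this

theorem take (hn : FP k fun A u => unary (n A u)) (h₀ : FP k g₀) :
    FP k fun A u => (g₀ A u).take (n A u) := by
  refine (congrArg (FP k) ?_).mp (hn.reverse_take (hn.reverse_take h₀))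
  funext A u
  rw [List.take_of_length_le (l := ((g₀ A u).take (n A u)).reverse) (by simp),
    List.reverse_reverse]

theorem strSucc (h₀ : FP k g₀) : FP k fun A u => _root_.strSucc (g₀ A u) := by
  have := FP.strRec (k := k) (g := fun _ w => (w 0).head?.elim [] fun b =>
      bif b then false :: w 1 else true :: (w 0).tail) (const [false]) h₀
    ((proj 0).cases nil ((proj 1).cons false) ((proj 0).tail.cons true)) .X
    (fun A u s l => by
      rw [Polynomial.eval_X]
      refine le_trans ?_ (show l.length + s.length ≤ _ by omega)
      induction l with
      | nil => simp [_root_.strRec]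
      | cons b l ih =>
        cases b
        · simp [_root_.strRec]
        · simp only [_root_.strRec, List.length_cons]
          exact (Nat.add_le_add_right ih 1).trans (by omega))
  refine (congrArg (FP k) ?_).mp this
  funext A u
  induction g₀ A u with
  | nil => rfl
  | cons b l ih =>
    cases b
    · rfl
    · simp only [_root_.strRec, _root_.strSucc, ih]
      simp [← ih]

theorem length_strSucc_le (l : List Bool) : (_root_.strSucc l).length ≤ l.length + 1 := by
  induction l with
  | nil => simp [_root_.strSucc]
  | cons b l ih => cases b <;> simp [_root_.strSucc, ih]

theorem nthStr (hn : FP k fun A u => unary (n A u)) : FP k fun A u => _root_.nthStr (n A u) := by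
  have := recursion (g := fun _ _ r _ => _root_.strSucc r) nil hn (proj 1).strSucc 1
    (fun A c r u => by simpa using length_strSucc_le r)
  refine (congrArg (FP k) ?_).mp this
  funext A u
  induction n A u with
  | zero => rfl
  | succ n ih =>
    rw [unary, List.replicate_succ, _root_.strRec, ih, _root_.nthStr, _root_.nthStr,
      Function.iterate_succ_apply']

theorem castVote (h₀ : FP k g₀) (h₁ : FP k g₁) :
    FP k fun A u => _root_.castVote (g₀ A u) (g₁ A u) :=
  h₁.cases h₀ (h₀.cases h₁ (h₁.cons true) h₁.tail) (h₀.cases h₁ h₁.tail (h₁.cons false))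

end FP

/-! ### Bounded quantifiers and majority votes -/

/-- The number of a string in the list of all strings. -/
def strRank : List Bool → ℕ
  | [] => 0
  | b :: l => 2 * strRank l + 1 + b.toNat

theorem iterate_strSucc_cons (n : ℕ) :
    strSucc^[2 * n + 1] [] = false :: nthStr n := by
  induction n with
  | zero => rfl
  | succ n ih =>
    rw [show 2 * (n + 1) + 1 = (2 * n + 1) + 1 + 1 by ring, Function.iterate_succ_apply',
      Function.iterate_succ_apply', ih, nthStr, nthStr, Function.iterate_succ_apply']
    rfl

theorem nthStr_strRank (l : List Bool) : nthStr (strRank l) = l := by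
  induction l with
  | nil => rfl
  | cons b l ih =>
    cases b
    · exact (iterate_strSucc_cons _).trans (by rw [ih])
    · rw [nthStr, strRank, Bool.toNat_true, Function.iterate_succ_apply', iterate_strSucc_cons, ih]
      rfl

theorem strRank_lt (l : List Bool) : strRank l < 2 ^ (l.length + 1) := by
  suffices strRank l + 2 ≤ 2 ^ (l.length + 1) by omega
  induction l with
  | nil => simp [strRank]
  | cons b l ih =>
    have := b.toNat_le
    rw [strRank, List.length_cons, pow_succ]
    omega

/-- The strings of length `ℓ` occur among the first `2 ^ (ℓ + 1)` strings. -/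
theorem strRank_lt_of_length_le {l : List Bool} {N : ℕ} (h : 2 ^ (l.length + 1) ≤ N) :
    strRank l < N := (strRank_lt l).trans_le h

/-- The truth value of "for all `j < n` the string `P j` starts with `true`". -/
def forallBit (P : ℕ → List Bool) : ℕ → List Bool
  | 0 => [true]
  | n + 1 => (P n).head?.elim [false] fun b => bif b then forallBit P n else [false]

/-- The truth value of "for some `j < n` the string `P j` starts with `true`". -/
def existsBit (P : ℕ → List Bool) : ℕ → List Bool
  | 0 => [false]
  | n + 1 => (P n).head?.elim (existsBit P n) fun b => bif b then [true] else existsBit P n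

/-- The outcome of the votes `P j` for `j < n`. -/
def tally (P : ℕ → List Bool) : ℕ → List Bool
  | 0 => []
  | n + 1 => castVote (P n) (tally P n)

open Classical in
theorem forallBit_eq (P : ℕ → List Bool) (n : ℕ) :
    forallBit P n = [decide (∀ j < n, (P j).head? = some true)] := by
  induction n with
  | zero => simp [forallBit]
  | succ n ih =>
    simp only [forallBit, ih, Nat.forall_lt_succ_right]
    rcases (P n).head? with _ | _ | _ <;> simp

open Classical in
theorem existsBit_eq (P : ℕ → List Bool) (n : ℕ) :
    existsBit P n = [decide (∃ j < n, (P j).head? = some true)] := by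
  induction n with
  | zero => simp [existsBit]
  | succ n ih =>
    simp only [existsBit, ih, Nat.exists_lt_succ_right]
    rcases (P n).head? with _ | _ | _ <;> simp

/-- The stack of the voting procedure if the difference of the numbers of votes is `d`. -/
def voteStack (d : ℤ) : List Bool := List.replicate d.natAbs (decide (0 < d))

theorem voteStack_natCast (n : ℕ) : voteStack n = List.replicate n true := by
  cases n with
  | zero => rfl
  | succ n => rw [voteStack, Int.natAbs_natCast, decide_eq_true (by omega)]

theorem voteStack_neg_natCast (n : ℕ) : voteStack (-n) = List.replicate n false := by
  rw [voteStack, Int.natAbs_neg, Int.natAbs_natCast, decide_eq_false (by omega)]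

theorem castVote_voteStack (b : Bool) (d : ℤ) :
    castVote [b] (voteStack d) = voteStack (d + if b then 1 else -1) := by
  obtain ⟨n, rfl | rfl⟩ := d.eq_nat_or_neg
  · rw [voteStack_natCast]
    cases b
    · cases n with
      | zero => rfl
      | succ n =>
        rw [show ((n + 1 : ℕ) : ℤ) + (if false = true then 1 else -1) = n by simp,
          voteStack_natCast]
        simp [castVote, List.replicate_succ]
    · rw [show (n : ℤ) + (if true = true then 1 else -1) = (n + 1 : ℕ) by simp, voteStack_natCast]
      cases n <;> simp [castVote, List.replicate_succ]
  · rw [voteStack_neg_natCast]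
    cases b
    · rw [show -(n : ℤ) + (if false = true then 1 else -1) = -(n + 1 : ℕ) by simp; ring,
        voteStack_neg_natCast]
      cases n <;> simp [castVote, List.replicate_succ]
    · cases n with
      | zero => rfl
      | succ n =>
        rw [show -((n + 1 : ℕ) : ℤ) + (if true = true then 1 else -1) = -n by simp,
          voteStack_neg_natCast]
        simp [castVote, List.replicate_succ]

theorem tally_eq (v : ℕ → Bool) (n : ℕ) : tally (fun j => [v j]) n =
    voteStack (∑ j ∈ Finset.range n, if v j then (1 : ℤ) else -1) := by
  induction n with
  | zero => rfl
  | succ n ih => rw [tally, ih, Finset.sum_range_succ, castVote_voteStack]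

theorem head?_tally (v : ℕ → Bool) (n : ℕ) : (tally (fun j => [v j]) n).head? = some true ↔
    0 < ∑ j ∈ Finset.range n, if v j then (1 : ℤ) else -1 := by
  rw [tally_eq, voteStack, List.head?_replicate]
  split_ifs with h
  · rw [Int.natAbs_eq_zero] at h; simp [h]
  · simp

namespace FP

variable {k : ℕ} {n : Language Bool → (Fin k → List Bool) → ℕ}
  {P : Language Bool → ℕ → (Fin k → List Bool) → List Bool}

/-- A recursion whose step depends only on the number of the remaining symbols. -/
theorem recursion_unary (hn : FP k fun A u => unary (n A u))
    (hP : FP (k + 1) fun A w => P A (w 0).length fun i => w i.succ)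
    {h : List Bool → List Bool → List Bool} (hh : FP 2 fun _ w => h (w 0) (w 1))
    (hlen : ∀ A j u r, (h (P A j u) r).length ≤ r.length + 1) (s : List Bool) :
    FP k fun A u => _root_.strRec s (fun c r => h (P A c.tail.length u) r) (unary (n A u)) := by
  have hP' : FP (k + 2) fun A w => P A (w 0).tail.length fun i => w i.succ.succ :=
    hP.comp (g := Fin.cons (fun _ w => (w 0).tail) fun i _ w => w i.succ.succ) fun i =>
      Fin.cases (proj 0).tail (fun i => proj _) i
  exact recursion (g := fun A c r u => h (P A c.tail.length u) r) (const s) hn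
    (hh.comp2 (f := fun _ x y => h x y) hP' (proj 1)) 1 (fun A c r u => by simpa using hlen A _ u r)

theorem forallBit (hn : FP k fun A u => unary (n A u))
    (hP : FP (k + 1) fun A w => P A (w 0).length fun i => w i.succ) :
    FP k fun A u => _root_.forallBit (fun j => P A j u) (n A u) := by
  refine (congrArg (FP k) ?_).mp (hn.recursion_unary hP
    (h := fun p r => p.head?.elim [false] fun b => bif b then r else [false])
    ((proj 0).cases (const [false]) (proj 1) (const [false]))
    (fun A j u r => by rcases (P A j u).head? with _ | _ | _ <;> simp) [true])
  funext A u
  induction n A u with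
  | zero => rfl
  | succ n ih =>
    rw [unary, List.replicate_succ, _root_.strRec, ih, List.tail_cons, List.length_replicate]; rfl

theorem existsBit (hn : FP k fun A u => unary (n A u))
    (hP : FP (k + 1) fun A w => P A (w 0).length fun i => w i.succ) :
    FP k fun A u => _root_.existsBit (fun j => P A j u) (n A u) := by
  refine (congrArg (FP k) ?_).mp (hn.recursion_unary hP
    (h := fun p r => p.head?.elim r fun b => bif b then [true] else r)
    ((proj 0).cases (proj 1) (const [true]) (proj 1))
    (fun A j u r => by rcases (P A j u).head? with _ | _ | _ <;> simp) [false])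
  funext A u
  induction n A u with
  | zero => rfl
  | succ n ih =>
    rw [unary, List.replicate_succ, _root_.strRec, ih, List.tail_cons, List.length_replicate]; rfl

theorem tally (hn : FP k fun A u => unary (n A u))
    (hP : FP (k + 1) fun A w => P A (w 0).length fun i => w i.succ)
    (hP1 : ∀ A j u, ∃ b, P A j u = [b]) :
    FP k fun A u => _root_.tally (fun j => P A j u) (n A u) := by
  refine (congrArg (FP k) ?_).mp (hn.recursion_unary hP
    (h := fun p r => _root_.castVote p r) ((proj 0).castVote (proj 1)) (fun A j u r => ?_) [])
  · funext A u
    induction n A u with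
    | zero => rfl
    | succ n ih =>
      rw [unary, List.replicate_succ, _root_.strRec, ih, List.tail_cons, List.length_replicate]; rfl
  · obtain ⟨b, hb⟩ := hP1 A j u
    rw [hb]
    cases r with
    | nil => simp [_root_.castVote]
    | cons c r => cases b <;> cases c <;> simp [_root_.castVote] <;> omega

end FP

/-! ### Coin flips -/

/-- The expectation of `f r` for a uniformly random string `r` of `m` bits. -/
def coinMean (m : ℕ) (f : List Bool → ℝ) : ℝ :=
  (∑ v : List.Vector Bool m, f v.toList) / 2 ^ m

open Classical in
theorem coinProb_eq (m : ℕ) (P : List Bool → Prop) :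
    coinProb m P = coinMean m fun r => if P r then 1 else 0 := by
  rw [coinProb, coinMean, Finset.sum_boole]

theorem coinMean_mono {m : ℕ} {f g : List Bool → ℝ} (h : ∀ r, r.length = m → f r ≤ g r) :
    coinMean m f ≤ coinMean m g :=
  div_le_div_of_nonneg_right (Finset.sum_le_sum fun v _ => h _ v.toList_length) (by positivity)

theorem coinMean_congr {m : ℕ} {f g : List Bool → ℝ} (h : ∀ r, r.length = m → f r = g r) :
    coinMean m f = coinMean m g :=
  le_antisymm (coinMean_mono fun r hr => (h r hr).le) (coinMean_mono fun r hr => (h r hr).ge)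

theorem coinMean_mul_const (m : ℕ) (f : List Bool → ℝ) (c : ℝ) :
    coinMean m (fun r => f r * c) = coinMean m f * c := by
  rw [coinMean, coinMean, ← Finset.sum_mul, div_mul_eq_mul_div]

theorem coinMean_add (m : ℕ) (f g : List Bool → ℝ) :
    coinMean m (fun r => f r + g r) = coinMean m f + coinMean m g := by
  rw [coinMean, coinMean, coinMean, ← add_div, Finset.sum_add_distrib]

theorem coinMean_const (m : ℕ) (c : ℝ) : coinMean m (fun _ => c) = c := by
  rw [coinMean, Finset.sum_const, Finset.card_univ, card_vector, nsmul_eq_mul]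
  simp

theorem coinMean_finset_sum {ι : Type} (s : Finset ι) (m : ℕ) (f : ι → List Bool → ℝ) :
    coinMean m (fun r => ∑ i ∈ s, f i r) = ∑ i ∈ s, coinMean m (f i) := by
  simp only [coinMean]
  rw [← Finset.sum_div, Finset.sum_comm]

theorem coinMean_zero (f : List Bool → ℝ) : coinMean 0 f = f [] := by
  have : ∀ v : List.Vector Bool 0, f v.toList = f [] := fun v => by rw [v.eq_nil]; rfl
  rw [coinMean, Finset.sum_congr rfl fun v _ => this v, Finset.sum_const, Finset.card_univ,
    card_vector]
  simp

theorem coinMean_succ (m : ℕ) (f : List Bool → ℝ) : coinMean (m + 1) f =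
    (coinMean m (fun r => f (true :: r)) + coinMean m fun r => f (false :: r)) / 2 := by
  have e : ∑ v : List.Vector Bool (m + 1), f v.toList =
      ∑ p : Bool × List.Vector Bool m, f (p.1 :: p.2.toList) := by
    refine Fintype.sum_equiv ⟨fun v => (v.head, v.tail), fun p => p.1 ::ᵥ p.2,
      fun v => v.cons_head_tail, fun p => by simp⟩ _ _ fun v => ?_
    simp only [Equiv.coe_fn_mk]
    rw [← List.Vector.toList_cons, v.cons_head_tail]
  rw [coinMean, e, Fintype.sum_prod_type, Fintype.sum_bool, coinMean, coinMean, pow_succ]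
  field_simp

theorem coinMean_append (m n : ℕ) (f : List Bool → ℝ) :
    coinMean (m + n) f = coinMean m fun a => coinMean n fun b => f (a ++ b) := by
  induction m generalizing f with
  | zero => rw [Nat.zero_add, coinMean_zero]; rfl
  | succ m ih => rw [Nat.succ_add, coinMean_succ, coinMean_succ, ih, ih]; rfl

/-- The `l`-th block of length `T` of a string. -/
def block (T l : ℕ) (r : List Bool) : List Bool := (r.drop (l * T)).take T

theorem block_zero_append {T : ℕ} {a b : List Bool} (ha : a.length = T) :
    block T 0 (a ++ b) = a := by
  rw [block, Nat.zero_mul, List.drop_zero, ← ha, List.take_left]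

theorem block_succ_append {T l : ℕ} {a b : List Bool} (ha : a.length = T) :
    block T (l + 1) (a ++ b) = block T l b := by
  rw [block, block, Nat.succ_mul, Nat.add_comm, ← List.drop_drop, ← ha, List.drop_left]

theorem coinMean_prod_block (T K : ℕ) (φ : List Bool → ℝ) :
    coinMean (K * T) (fun r => ∏ l ∈ Finset.range K, φ (block T l r)) = coinMean T φ ^ K := by
  induction K with
  | zero => rw [Nat.zero_mul, coinMean_zero]; simp
  | succ K ih =>
    rw [Nat.succ_mul, Nat.add_comm, coinMean_append, pow_succ', ← ih, ← coinMean_mul_const]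
    refine coinMean_congr fun a ha => ?_
    rw [mul_comm (φ a), ← coinMean_mul_const]
    refine coinMean_congr fun b _ => ?_
    rw [Finset.prod_range_succ', block_zero_append ha]
    simp only [block_succ_append ha]

/-- If an event has probability at most `1/3`, then it happens in at least half of `K` independent
trials with exponentially small probability: give the factor `4/3` to the trials in which it
happens and `3/4` to the others; the product has expectation at most `(17/18) ^ K`, and it is at
least `1` in the case in question. -/
theorem coinProb_half_le (T K : ℕ) (P : List Bool → Prop) [DecidablePred P]
    (h : coinProb T P ≤ 1 / 3) :
    coinProb (K * T) (fun r => 0 ≤ ∑ l ∈ Finset.range K, if P (block T l r) then (1 : ℤ) else -1) ≤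
      (17 / 18) ^ K := by
  classical
  let e : List Bool → ℤ := fun r => if P r then 1 else -1
  have h1 : coinMean T (fun r => (4 / 3 : ℝ) ^ e r) ≤ 17 / 18 := by
    have : ∀ r, (4 / 3 : ℝ) ^ e r = (if P r then 1 else 0) * (7 / 12) + 3 / 4 := by
      intro r
      by_cases hr : P r <;> norm_num [e, hr]
    simp only [this]
    rw [coinMean_add, coinMean_mul_const, coinMean_const]
    have h2 : coinMean T (fun r => if P r then 1 else 0) ≤ 1 / 3 := by
      convert h using 1
      rw [coinProb_eq]
      congr!
    linarith
  have h0 : 0 ≤ coinMean T (fun r => (4 / 3 : ℝ) ^ e r) := by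
    rw [← coinMean_const T 0]
    exact coinMean_mono fun r _ => by positivity
  refine le_trans ?_ (pow_le_pow_left₀ h0 h1 K)
  rw [← coinMean_prod_block, coinProb_eq]
  refine coinMean_mono fun r _ => ?_
  have hz : ∀ n, ∏ l ∈ Finset.range n, (4 / 3 : ℝ) ^ e (block T l r) =
      (4 / 3 : ℝ) ^ ∑ l ∈ Finset.range n, e (block T l r) := by
    intro n
    induction n with
    | zero => simp
    | succ n ih =>
      rw [Finset.prod_range_succ, ih, Finset.sum_range_succ, zpow_add₀ (by norm_num)]
  rw [hz]
  split_ifs with hr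
  · exact one_le_zpow₀ (by norm_num) hr
  · positivity

theorem coinProb_mono {m : ℕ} {P Q : List Bool → Prop} (h : ∀ r, r.length = m → P r → Q r) :
    coinProb m P ≤ coinProb m Q := by
  classical
  rw [coinProb_eq, coinProb_eq]
  refine coinMean_mono fun r hr => ?_
  have := h r hr
  split_ifs <;> simp_all

theorem coinProb_not (m : ℕ) (P : List Bool → Prop) : coinProb m (fun r => ¬ P r) =
    1 - coinProb m P := by
  classical
  rw [coinProb_eq, coinProb_eq, eq_sub_iff_add_eq, ← coinMean_add]
  refine (coinMean_congr fun r _ => ?_).trans (coinMean_const m 1)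
  by_cases h : P r <;> simp [h]

theorem coinProb_exists_le {ι : Type} (s : Finset ι) (m : ℕ) (P : ι → List Bool → Prop) {c : ℝ}
    (h : ∀ i ∈ s, coinProb m (P i) ≤ c) : coinProb m (fun r => ∃ i ∈ s, P i r) ≤ s.card * c := by
  classical
  refine le_trans ?_ ((Finset.sum_le_sum h).trans_eq (by rw [Finset.sum_const, nsmul_eq_mul]))
  simp only [coinProb_eq]
  rw [← coinMean_finset_sum]
  refine coinMean_mono fun r _ => ?_
  split_ifs with hr
  · obtain ⟨i, hi, hr⟩ := hr
    refine le_trans ?_ (Finset.single_le_sum (f := fun i => if P i r then (1 : ℝ) else 0)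
      (fun i _ => by split_ifs <;> norm_num) hi)
    simp [hr]
  · exact Finset.sum_nonneg fun i _ => by split_ifs <;> norm_num

/-- If the first coin flips are good with probability `p`, and for good first coin flips the
remaining ones are good with probability `q`, then all are good with probability `p * q`. -/
theorem mul_le_coinProb_append {m n : ℕ} {P R : List Bool → Prop} {p q : ℝ}
    (hq : 0 ≤ q) (hP : p ≤ coinProb m P)
    (h : ∀ a, a.length = m → P a → q ≤ coinProb n fun b => R (a ++ b)) :
    p * q ≤ coinProb (m + n) R := by
  classical
  refine (mul_le_mul_of_nonneg_right hP hq).trans ?_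
  rw [coinProb_eq, coinProb_eq, coinMean_append, ← coinMean_mul_const]
  refine coinMean_mono fun a ha => ?_
  split_ifs with hPa
  · rw [one_mul]
    exact (h a ha hPa).trans_eq (coinProb_eq _ _)
  · rw [zero_mul]
    refine (coinMean_const n 0).symm.trans_le (coinMean_mono fun b _ => ?_)
    split_ifs <;> norm_num

/-- Majority votes are reliable: if a bit is equal to `b` with probability at least `2/3`, then a
vote of `K` independent copies yields `b` except with exponentially small probability. -/
theorem coinProb_tally_le (T K : ℕ) (f : List Bool → Bool) (b : Bool)
    (h : 2 / 3 ≤ coinProb T fun r => f r = b) :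
    coinProb (K * T) (fun r => ¬ ((tally (fun l => [f (block T l r)]) K).head? = some true ↔
      b = true)) ≤ (17 / 18) ^ K := by
  have h' : coinProb T (fun r => f r ≠ b) ≤ 1 / 3 := by
    rw [coinProb_not]; linarith
  refine le_trans (coinProb_mono fun r _ hr => ?_) (coinProb_half_le T K (fun r => f r ≠ b) h')
  rw [head?_tally (fun l => f (block T l r))] at hr
  cases b
  · have e : (fun l => if f (block T l r) ≠ false then (1 : ℤ) else -1) =
        fun l => if f (block T l r) = true then 1 else -1 := by
      funext l; cases f (block T l r) <;> rfl
    rw [e]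
    simp at hr
    exact hr.le
  · have e : (fun l => if f (block T l r) ≠ true then (1 : ℤ) else -1) =
        fun l => - if f (block T l r) = true then 1 else -1 := by
      funext l; cases f (block T l r) <;> rfl
    rw [e, Finset.sum_neg_distrib]
    simp at hr
    omega

/-! ### From a selector to the elimination of advice -/

theorem OracleTM.PolyTime.exists_fp {k : ℕ} {M : OracleTM k} (hM : M.PolyTime) :
    ∃ f, FP k f ∧ ∀ A u, M.Outputs A u (f A u) := by
  have := hM
  obtain ⟨p, hp⟩ := this
  have h : ∀ A u, M.Outputs A u ((M.run A u (p.eval (∑ i, (u i).length))).stk (.inr M.outputTape)) :=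
    fun A u => ⟨_, hp A u, rfl⟩
  exact ⟨_, FP.of_polyTime hM h, h⟩

theorem OracleTM.OracleFree.run_eq {k : ℕ} {M : OracleTM k} (hM : M.OracleFree)
    (A A' : Language Bool) (u : Fin k → List Bool) (n : ℕ) : M.run A u n = M.run A' u n := by
  have : M.toRoutine.step A = M.toRoutine.step A' := by
    funext ⟨l, v, S⟩
    cases l with
    | none => rfl
    | some l => rw [M.toRoutine.step_prog A (hM l) v S, M.toRoutine.step_prog A' (hM l) v S]
  rw [M.run_eq, M.run_eq, this]

namespace FP

/-- The value on `u` depends on the strings of polynomial length in the oracle only. -/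
theorem exists_query_bound {k : ℕ} {f : Language Bool → (Fin k → List Bool) → List Bool}
    (hf : FP k f) : ∃ Q : Polynomial ℕ, ∀ (A A' : Language Bool) u,
      (∀ q : List Bool, q.length ≤ Q.eval (∑ i, (u i).length) → (q ∈ A ↔ q ∈ A')) →
        f A u = f A' u := by
  obtain ⟨M, ⟨p, hp⟩, hM⟩ := hf
  obtain ⟨c, hc⟩ := M.exists_query_bound
  refine ⟨c * p, fun A A' u h => ?_⟩
  rw [← (hM A u).eq_of_run (hp A u), ← (hM A' u).eq_of_run (hp A' u)]
  rw [hc A A' u _ (by simpa using h)]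

variable {k : ℕ} {m n : Language Bool → (Fin k → List Bool) → ℕ}

theorem block (hm : FP k fun A u => unary (m A u)) (hn : FP k fun A u => unary (n A u))
    {g : Language Bool → (Fin k → List Bool) → List Bool} (hg : FP k g) :
    FP k fun A u => _root_.block (m A u) (n A u) (g A u) :=
  hm.take ((hn.mul hm).drop hg)

theorem comp6 {f : Language Bool → List Bool → List Bool → List Bool → List Bool → List Bool →
      List Bool → List Bool} (hf : FP 6 fun A w => f A (w 0) (w 1) (w 2) (w 3) (w 4) (w 5))
    {g₀ g₁ g₂ g₃ g₄ g₅ : Language Bool → (Fin k → List Bool) → List Bool} (h₀ : FP k g₀)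
    (h₁ : FP k g₁) (h₂ : FP k g₂) (h₃ : FP k g₃) (h₄ : FP k g₄) (h₅ : FP k g₅) :
    FP k fun A u => f A (g₀ A u) (g₁ A u) (g₂ A u) (g₃ A u) (g₄ A u) (g₅ A u) :=
  hf.comp (g := ![g₀, g₁, g₂, g₃, g₄, g₅]) fun i => by
    fin_cases i; exacts [h₀, h₁, h₂, h₃, h₄, h₅]

end FP

/-- The data of the simulation of a selector for a language with advice: the functions computed by
the padding machine, the machine that takes advice and the selector, and bounds for the padded
length `m`, the numbers `t`, `T` of coin flips of the machine and of the selector, the number `K` of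
repetitions and the number `N` of advice strings. -/
structure AdviceSearch where
  /-- the function that pads its first argument to the length of the second one -/
  pad : Language Bool → List Bool → List Bool → List Bool
  /-- the function computed from the input, the coin flips, and the advice -/
  adv : Language Bool → List Bool → List Bool → List Bool → List Bool
  /-- the function computed by the selector from the input and the coin flips -/
  sel : Language Bool → List Bool → List Bool → List Bool
  /-- the padded length -/
  m : Polynomial ℕ
  /-- the number of coin flips of the machine that takes advice -/
  t : Polynomial ℕ
  /-- the number of coin flips of the selector -/
  T : Polynomial ℕ
  /-- the number of repetitions -/
  K : Polynomial ℕ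
  /-- the number of advice strings -/
  N : Polynomial ℕ
  fp_pad : FP 2 fun A w => pad A (w 0) (w 1)
  fp_adv : FP 3 fun A w => adv A (w 0) (w 1) (w 2)
  fp_sel : FP 2 fun A w => sel A (w 0) (w 1)

namespace AdviceSearch

variable (D : AdviceSearch)

/-- Is `q` in the language, according to the advice `γ`?  The string `μ` has the padded length and
`ρ` consists of coin flips. -/
def answer (A : Language Bool) (q μ ρ γ : List Bool) : List Bool :=
  firstBit (D.adv A (D.pad A q μ) ρ γ)

/-- The answers of the join of the oracles that are given by the advice strings `α` and `β`. -/
def joinAnswer (A : Language Bool) (q μ ρ α β : List Bool) : List Bool :=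
  q.head?.elim [false] fun b =>
    bif b then D.answer A q.tail μ ρ β else D.answer A q.tail μ ρ α

/-- The answer of the selector, with coin flips `s`, when it has access to the join of the oracles
that are given by the advice strings `α` and `β`. -/
def vote (A : Language Bool) (x s μ ρ α β : List Bool) : List Bool :=
  firstBit (D.sel {q | D.joinAnswer A q μ ρ α β = [true]} x s)

/-- The final answer: there is an advice string such that, whichever advice string it is compared
with, the majority of the answers of the selector is positive. -/
def result (A : Language Bool) (x r : List Bool) : List Bool :=
  existsBit (fun i => forallBit (fun j => tally (fun l =>
    D.vote A x (block (D.T.eval x.length) l (r.drop (D.t.eval (D.m.eval x.length))))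
      (unary (D.m.eval x.length)) (r.take (D.t.eval (D.m.eval x.length))) (nthStr i) (nthStr j))
    (D.K.eval x.length)) (D.N.eval x.length)) (D.N.eval x.length)

theorem exists_joinAnswer_eq (A : Language Bool) (q μ ρ α β : List Bool) :
    ∃ b, D.joinAnswer A q μ ρ α β = [b] := by
  rcases q with _ | ⟨_ | _, q⟩
  · exact ⟨false, rfl⟩
  · exact firstBit_eq _
  · exact firstBit_eq _

theorem fp_vote : FP 6 fun A w => D.vote A (w 0) (w 1) (w 2) (w 3) (w 4) (w 5) := by
  have h : ∀ i : Fin 7, FP 7 fun A w => D.answer A (w 0).tail (w 3) (w 4) (w i) := fun i =>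
    (D.fp_adv.comp3 (f := D.adv) (D.fp_pad.comp2 (f := D.pad) (FP.proj 0).tail (FP.proj 3))
      (FP.proj 4) (FP.proj i)).firstBit
  have hj : FP 7 fun A w => D.joinAnswer A (w 0) (w 3) (w 4) (w 5) (w 6) :=
    (FP.proj 0).cases (FP.const [false]) (h 6) (h 5)
  exact (D.fp_sel.subst hj (fun A u => D.exists_joinAnswer_eq _ _ _ _ _ _) ![0, 1]).firstBit

theorem fp_result : FP 2 fun A w => D.result A (w 0) (w 1) := by
  have hm : ∀ {k : ℕ} (i : Fin k) (p : Polynomial ℕ), FP k fun _ w => unary (p.eval (w i).length) :=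
    fun i p => (FP.proj i).length.polynomial p
  have ht : ∀ {k : ℕ} (i : Fin k), FP k fun _ w => unary (D.t.eval (D.m.eval (w i).length)) :=
    fun i => (hm i D.m).polynomial D.t
  refine (hm 0 D.N).existsBit (P := fun A i w => _) ((hm 1 D.N).forallBit (P := fun A j w => _)
    ((hm 2 D.K).tally (P := fun A l w => _) (D.fp_vote.comp6 (f := D.vote) (FP.proj 3)
      (((hm 3 D.T).block (FP.proj 0).length ((ht 3).drop (FP.proj 4)))) (hm 3 D.m)
      ((ht 3).take (FP.proj 4)) (FP.proj 2).length.nthStr (FP.proj 1).length.nthStr)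
      fun A j u => firstBit_eq _))

end AdviceSearch

open Classical in
theorem firstBit_eq_decide (l : List Bool) : firstBit l = [decide (l.head? = some true)] := by
  rcases l with _ | ⟨_ | _, l⟩ <;> simp [firstBit]

/-- After `170 * N` repetitions, none of `2 * N` majority votes is wrong, except with probability at
most `1/5`. -/
theorem two_mul_mul_pow_le (N : ℕ) : 2 * (N : ℝ) * (17 / 18) ^ (170 * N) ≤ 1 / 5 := by
  -- Bernoulli's inequality gives `(18 / 17) ^ (170 * N) ≥ 1 + 10 * N`.
  have h := one_add_mul_le_pow (show (-2 : ℝ) ≤ 1 / 17 by norm_num) (170 * N)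
  have h1 : (17 / 18 : ℝ) ^ (170 * N) * (1 + 1 / 17) ^ (170 * N) = 1 := by
    rw [← mul_pow]; norm_num
  have h2 : (0 : ℝ) ≤ (17 / 18 : ℝ) ^ (170 * N) := by positivity
  push_cast at h
  nlinarith [mul_le_mul_of_nonneg_left h h2]

namespace AdviceSearch

variable (D : AdviceSearch) {L R : Language Bool} {m : ℕ}

/-- The language decided with advice `γ` and coin flips `ρ`.  Strings longer than `m`, which cannot
be padded to the length `m`, are treated as by `L`, so that correct advice gives exactly `L`. -/
def adviceLanguage (L R : Language Bool) (m : ℕ) (ρ γ : List Bool) : Language Bool :=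
  {q | if q.length ≤ m then D.answer R q (unary m) ρ γ = [true] else q ∈ L}

theorem adviceLanguage_eq (hpad : ∀ A q m, q.length ≤ m →
      (D.pad A q (unary m)).length = m ∧ (D.pad A q (unary m) ∈ L ↔ q ∈ L)) {ρ γ : List Bool}
    (hγ : ∀ x : List Bool, x.length = m → D.adv R x ρ γ = charBit L x) :
    D.adviceLanguage L R m ρ γ = L := by
  classical
  ext q
  change (if q.length ≤ m then D.answer R q (unary m) ρ γ = [true] else q ∈ L) ↔ q ∈ L
  split_ifs with hq
  · obtain ⟨h1, h2⟩ := hpad R q m hq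
    rw [answer, hγ _ h1, ← h2, charBit, firstBit_eq_decide]
    simp
  · rfl

/-- On short queries, the simulated oracle is the join of two advice languages. -/
theorem mem_joinOracle_iff {ρ α β q : List Bool} (hq : q.length ≤ m + 1) :
    q ∈ ({q | D.joinAnswer R q (unary m) ρ α β = [true]} : Language Bool) ↔
      q ∈ joinOracle (D.adviceLanguage L R m ρ α) (D.adviceLanguage L R m ρ β) := by
  change D.joinAnswer R q (unary m) ρ α β = [true] ↔
    ∃ q', (q = false :: q' ∧ q' ∈ D.adviceLanguage L R m ρ α) ∨
      (q = true :: q' ∧ q' ∈ D.adviceLanguage L R m ρ β)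
  have hmem : ∀ γ q', q'.length ≤ m → (q' ∈ D.adviceLanguage L R m ρ γ ↔
      D.answer R q' (unary m) ρ γ = [true]) := fun γ q' h => by
    change (if q'.length ≤ m then _ else _) ↔ _
    rw [if_pos h]
  rcases q with _ | ⟨_ | _, q⟩
  · simp [joinAnswer]
  · rw [List.length_cons, Nat.add_le_add_iff_right] at hq
    simp [joinAnswer, hmem _ _ hq]
  · rw [List.length_cons, Nat.add_le_add_iff_right] at hq
    simp [joinAnswer, hmem _ _ hq]

/-- The comparison of a correct advice string with any other one gives the right answer, except with
exponentially small probability. -/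
theorem coinProb_vote_le {x ρ α β : List Bool}
    (hsel : ∀ A₀ A₁ : Language Bool, L = A₀ ∨ L = A₁ → 2 / 3 ≤ coinProb (D.T.eval x.length)
      fun r => D.sel (joinOracle A₀ A₁) x r = charBit L x)
    (hloc : ∀ (A A' : Language Bool) s, s.length = D.T.eval x.length →
      (∀ q : List Bool, q.length ≤ m + 1 → (q ∈ A ↔ q ∈ A')) → D.sel A x s = D.sel A' x s)
    (h : L = D.adviceLanguage L R m ρ α ∨ L = D.adviceLanguage L R m ρ β) (K : ℕ) :
    coinProb (K * D.T.eval x.length) (fun b => ¬ ((tally (fun l =>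
      D.vote R x (block (D.T.eval x.length) l b) (unary m) ρ α β) K).head? = some true ↔ x ∈ L)) ≤
      (17 / 18) ^ K := by
  classical
  have := coinProb_tally_le (D.T.eval x.length) K (fun s =>
    decide ((D.sel {q | D.joinAnswer R q (unary m) ρ α β = [true]} x s).head? = some true))
    (decide (x ∈ L)) ((hsel _ _ h).trans (coinProb_mono fun s hs e => ?_))
  · simpa only [vote, firstBit_eq_decide, decide_eq_true_eq] using this
  · rw [hloc _ _ s hs fun q hq => D.mem_joinOracle_iff (L := L) hq, e, charBit]
    simp

/-- Suppose that every comparison with the candidate `i₀`, on either side, gives the right answer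
`p`. If `p` is true then `i₀` wins all its comparisons, and otherwise no candidate beats `i₀`. -/
theorem head?_result_iff {N : ℕ} {P : ℕ → ℕ → List Bool} {p : Prop} {i₀ : ℕ} (hi : i₀ < N)
    (h₁ : ∀ j < N, ((P i₀ j).head? = some true ↔ p)) (h₂ : ∀ i < N, ((P i i₀).head? = some true ↔ p)) :
    (∃ i < N, ∀ j < N, (P i j).head? = some true) ↔ p :=
  ⟨fun ⟨i, hi', h⟩ => (h₂ i hi').1 (h i₀ hi), fun hp => ⟨i₀, hi, fun j hj => (h₁ j hj).2 hp⟩⟩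

/-- With probability `5/6` the advice `α ρ` is correct.  In this case, only its `2 * N` comparisons
with the advice strings matter, and by the union bound all of them give the right answer with
probability at least `4/5`. -/
theorem two_thirds_le_coinProb_result {x : List Bool} {α : List Bool → List Bool}
    (hpad : ∀ A q m, q.length ≤ m →
      (D.pad A q (unary m)).length = m ∧ (D.pad A q (unary m) ∈ L ↔ q ∈ L))
    (hsel : ∀ A₀ A₁ : Language Bool, L = A₀ ∨ L = A₁ → 2 / 3 ≤ coinProb (D.T.eval x.length)
      fun r => D.sel (joinOracle A₀ A₁) x r = charBit L x)
    (hm : D.m.eval x.length = m)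
    (hloc : ∀ (A A' : Language Bool) s, s.length = D.T.eval x.length →
      (∀ q : List Bool, q.length ≤ m + 1 → (q ∈ A ↔ q ∈ A')) → D.sel A x s = D.sel A' x s)
    (hadv : 5 / 6 ≤ coinProb (D.t.eval m) fun ρ => ∀ y : List Bool, y.length = m →
      D.adv R y ρ (α ρ) = charBit L y)
    (hα : ∀ ρ, ρ.length = D.t.eval m → 2 ^ ((α ρ).length + 1) ≤ D.N.eval x.length)
    (hK : D.K.eval x.length = 170 * D.N.eval x.length) :
    2 / 3 ≤ coinProb (D.t.eval m + D.K.eval x.length * D.T.eval x.length)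
      fun r => D.result R x r = charBit L x := by
  classical
  have h56 : (2 / 3 : ℝ) = 5 / 6 * (4 / 5) := by norm_num
  rw [h56]
  refine mul_le_coinProb_append (by norm_num) hadv fun ρ hρ hgood => ?_
  have hL := D.adviceLanguage_eq hpad hgood
  set N := D.N.eval x.length with hN
  set K := D.K.eval x.length with hKdef
  set i₀ := strRank (α ρ) with hi₀
  have hi₀N : i₀ < N := strRank_lt_of_length_le (hα ρ hρ)
  let P : List Bool → ℕ → ℕ → List Bool := fun b i j => tally (fun l =>
    D.vote R x (block (D.T.eval x.length) l b) (unary m) ρ (nthStr i) (nthStr j)) K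
  -- `E (c, j)`: the comparison of the correct candidate `i₀` with `j` goes wrong, where `c` says on
  -- which side `i₀` stands.
  let E : Bool × ℕ → List Bool → Prop := fun c b =>
    ¬ ((bif c.1 then P b i₀ c.2 else P b c.2 i₀).head? = some true ↔ x ∈ L)
  have hE : ∀ c ∈ (Finset.univ : Finset Bool) ×ˢ Finset.range N,
      coinProb (K * D.T.eval x.length) (E c) ≤ (17 / 18) ^ K := by
    rintro ⟨c, j⟩ -
    cases c
    · exact D.coinProb_vote_le hsel hloc (.inr (by rw [hi₀, nthStr_strRank, hL])) K
    · exact D.coinProb_vote_le hsel hloc (.inl (by rw [hi₀, nthStr_strRank, hL])) K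
  have hbad := coinProb_exists_le _ _ E hE
  have hle : (((Finset.univ : Finset Bool) ×ˢ Finset.range N).card : ℝ) * (17 / 18) ^ K ≤ 1 / 5 := by
    rw [Finset.card_product, Finset.card_univ, Fintype.card_bool, Finset.card_range, hK]
    push_cast
    exact two_mul_mul_pow_le N
  have hgood' := coinProb_not (K * D.T.eval x.length)
    fun b => ∃ c ∈ (Finset.univ : Finset Bool) ×ˢ Finset.range N, E c b
  refine le_trans (by linarith) (coinProb_mono (P := fun b => ¬ ∃ c ∈
    (Finset.univ : Finset Bool) ×ˢ Finset.range N, E c b) fun b _ hb => ?_)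
  have hP : ∀ c : Bool, ∀ j < N, ((bif c then P b i₀ j else P b j i₀).head? = some true ↔ x ∈ L) :=
    fun c j hj => not_not.1 fun h => hb ⟨(c, j), by simp [hj], h⟩
  rw [result, hm, List.take_left' hρ, List.drop_left' hρ, existsBit_eq, charBit]
  have := head?_result_iff (P := P b) hi₀N (fun j hj => hP true j hj) (fun j hj => hP false j hj)
  simp only [forallBit_eq, List.head?_cons, Option.some.injEq, decide_eq_true_eq]
  exact congrArg (fun b => [b]) (decide_eq_decide.2 this)

end AdviceSearch

/-- `O(log n)` bits of advice can be enumerated in polynomial time. -/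
theorem exists_two_pow_le_of_isBigO_log {a : ℕ → ℕ}
    (ha : (fun n => (a n : ℝ)) =O[atTop] fun n => Real.log n) :
    ∃ c n₀ : ℕ, ∀ n ≥ n₀, 2 ^ (a n + 1) ≤ 2 * n ^ c := by
  obtain ⟨C, hC⟩ := ha.bound
  obtain ⟨n₀, hn₀⟩ := eventually_atTop.1 hC
  refine ⟨⌈C⌉₊, max n₀ 1, fun n hn => ?_⟩
  have h1 : 1 ≤ n := (le_max_right _ _).trans hn
  have h := hn₀ n ((le_max_left _ _).trans hn)
  have hlog : 0 ≤ Real.log n := Real.log_natCast_nonneg n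
  rw [Real.norm_of_nonneg (Nat.cast_nonneg _), Real.norm_of_nonneg hlog] at h
  have h2 : (a n : ℝ) ≤ ⌈C⌉₊ * Real.log n :=
    h.trans (mul_le_mul_of_nonneg_right (Nat.le_ceil C) hlog)
  have h3 : (2 : ℝ) ^ a n ≤ (n : ℝ) ^ ⌈C⌉₊ := by
    have hn0 : (0 : ℝ) < n := by exact_mod_cast h1
    calc (2 : ℝ) ^ a n ≤ Real.exp 1 ^ a n :=
          pow_le_pow_left₀ (by norm_num) (by linarith [Real.add_one_le_exp (1 : ℝ)]) _
      _ = Real.exp (a n) := by rw [← Real.exp_nat_mul, mul_one]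
      _ ≤ Real.exp (⌈C⌉₊ * Real.log n) := Real.exp_le_exp.2 h2
      _ = (n : ℝ) ^ ⌈C⌉₊ := by rw [Real.exp_nat_mul, Real.exp_log hn0]
  have h4 : 2 ^ a n ≤ n ^ ⌈C⌉₊ := by exact_mod_cast h3
  rw [pow_succ, mul_comm]
  exact Nat.mul_le_mul_left 2 h4

/-- With a selector for a paddable language, coin-dependent advice of logarithmic length can be
eliminated. -/
theorem HasSelector.mem_BPP {L R : Language Bool} (hL : Paddable L) (hS : HasSelector L)
    (hR : L ∈ BPPCoinAdviceLog R) : L ∈ BPP R := by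
  obtain ⟨Mp, hfree, hpoly, hMp⟩ := hL
  obtain ⟨S, hSpoly, T, hT⟩ := hS
  obtain ⟨Ma, hMa, t, a, α, hlog, hαlen, hadv⟩ := hR
  obtain ⟨pad, fp_pad, hpad⟩ := hpoly.exists_fp
  obtain ⟨sel, fp_sel, hsel⟩ := hSpoly.exists_fp
  obtain ⟨adv, fp_adv, hadv'⟩ := hMa.exists_fp
  obtain ⟨Q, hQ⟩ := fp_sel.exists_query_bound
  obtain ⟨c, n₀, hc⟩ := exists_two_pow_le_of_isBigO_log hlog
  have e2 : ∀ w : Fin 2 → List Bool, ![w 0, w 1] = w := fun w => by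
    funext i; fin_cases i <;> rfl
  have e3 : ∀ w : Fin 3 → List Bool, ![w 0, w 1, w 2] = w := fun w => by
    funext i; fin_cases i <;> rfl
  -- All queries of the selector can be padded to the length `m`, which is also large enough for the
  -- bound on the number of advice strings.
  let m : Polynomial ℕ := Q.comp (.X + T) + n₀
  let N : Polynomial ℕ := 2 * m ^ c
  let D : AdviceSearch :=
    { pad := fun A q μ => pad A ![q, μ]
      adv := fun A x r γ => adv A ![x, r, γ]
      sel := fun A x r => sel A ![x, r]
      m := m
      t := t
      T := T
      K := 170 * N
      N := N
      fp_pad := by simpa only [e2] using fp_pad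
      fp_adv := by simpa only [e3] using fp_adv
      fp_sel := by simpa only [e2] using fp_sel }
  obtain ⟨M, hM, hMD⟩ := D.fp_result
  refine ⟨M, hM, t.comp m + 170 * N * T, fun x => ?_⟩
  have hm : m.eval x.length = Q.eval (x.length + T.eval x.length) + n₀ := by simp [m]
  have hN : N.eval x.length = 2 * m.eval x.length ^ c := by simp [N]
  have key := D.two_thirds_le_coinProb_result (L := L) (R := R) (x := x)
    (α := α (m.eval x.length)) (m := m.eval x.length) ?_ ?_ rfl ?_ ?_ ?_ (by simp [D])
  · have e : (t.comp m + 170 * N * T).eval x.length =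
        D.t.eval (m.eval x.length) + D.K.eval x.length * D.T.eval x.length := by simp [D]
    rw [e]
    refine key.trans (coinProb_mono fun r _ h => ?_)
    rw [← h]
    exact hMD R ![x, r]
  · intro A q m hq
    obtain ⟨y, ⟨n, hn, hy⟩, hlen, hmem⟩ := hMp q m hq
    have : pad A ![q, unary m] = y := by
      refine (hpad A ![q, unary m]).unique ⟨n, ?_, ?_⟩
      · rw [hfree.run_eq A ⊥]; exact hn
      · rw [hfree.run_eq A ⊥]; exact hy
    change (pad A ![q, unary m]).length = m ∧ (pad A ![q, unary m] ∈ L ↔ q ∈ L)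
    rw [this]
    exact ⟨hlen, hmem⟩
  · intro A₀ A₁ h
    exact (hT x A₀ A₁ h).trans (coinProb_mono fun r _ h => (hsel _ _).unique h)
  · intro A A' s hs h
    refine hQ A A' ![x, s] fun q hq => h q (hq.trans ?_)
    have hs' : s.length = T.eval x.length := hs
    rw [Fin.sum_univ_two]
    change Q.eval (x.length + s.length) ≤ _
    rw [hs', hm]
    omega
  · exact (hadv _).trans (coinProb_mono fun ρ _ h y hy => (hadv' _ _).unique (h y hy))
  · intro ρ hρ
    change _ ≤ N.eval x.length
    rw [hαlen _ ρ hρ, hN]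
    exact hc _ (by rw [hm]; omega)

/-! ### There are only countably many polynomial-time functions -/

/-- Statements over finite types are countable: read in reverse Polish notation, each of them is the
value of a list of instructions. -/
instance countable_stmt {K Λ σ : Type} [Finite K] [Finite Λ] [Finite σ] :
    Countable (TM2.Stmt (fun _ : K => Bool) Λ σ) := by
  let Q := TM2.Stmt (fun _ : K => Bool) Λ σ
  let G : Set (List Q → List Q) :=
    (Set.range fun (p : K × (σ → Bool)) s => .push p.1 p.2 (s.headD .halt) :: s.tail) ∪
    (Set.range fun (p : K × (σ → Option Bool → σ)) s => .peek p.1 p.2 (s.headD .halt) :: s.tail) ∪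
    (Set.range fun (p : K × (σ → Option Bool → σ)) s => .pop p.1 p.2 (s.headD .halt) :: s.tail) ∪
    (Set.range fun (f : σ → σ) s => .load f (s.headD .halt) :: s.tail) ∪
    (Set.range fun (f : σ → Bool) s =>
      .branch f (s.headD .halt) (s.tail.headD .halt) :: s.tail.tail) ∪
    (Set.range fun (f : σ → Λ) s => .goto f :: s) ∪ {fun s => .halt :: s}
  have hG : G.Countable := by
    simp only [G, Set.countable_union, Set.countable_singleton, and_true]
    refine ⟨⟨⟨⟨⟨?_, ?_⟩, ?_⟩, ?_⟩, ?_⟩, ?_⟩ <;> exact Set.countable_range _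
  have := hG.to_subtype
  let ev : List G → List Q := fun l => l.foldr (fun g s => g.1 s) []
  have key : ∀ (q : Q) (l : List G), ∃ l', ev l' = q :: ev l := by
    have step : ∀ g ∈ G, ∀ l s, g (ev l) = s → ∃ l', ev l' = s :=
      fun g hg l s h => ⟨⟨g, hg⟩ :: l, h⟩
    intro q
    induction q with
    | push k f q ih =>
      intro l
      obtain ⟨l', h⟩ := ih l
      exact step _ (.inl (.inl (.inl (.inl (.inl (.inl ⟨(k, f), rfl⟩)))))) l' _ (by simp [h])
    | peek k f q ih =>
      intro l
      obtain ⟨l', h⟩ := ih l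
      exact step _ (.inl (.inl (.inl (.inl (.inl (.inr ⟨(k, f), rfl⟩)))))) l' _ (by simp [h])
    | pop k f q ih =>
      intro l
      obtain ⟨l', h⟩ := ih l
      exact step _ (.inl (.inl (.inl (.inl (.inr ⟨(k, f), rfl⟩))))) l' _ (by simp [h])
    | load f q ih =>
      intro l
      obtain ⟨l', h⟩ := ih l
      exact step _ (.inl (.inl (.inl (.inr ⟨f, rfl⟩)))) l' _ (by simp [h])
    | branch f q₁ q₂ ih₁ ih₂ =>
      intro l
      obtain ⟨l', h⟩ := ih₂ l
      obtain ⟨l'', h'⟩ := ih₁ l'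
      exact step _ (.inl (.inl (.inr ⟨f, rfl⟩))) l'' _ (by simp [h', h])
    | goto f =>
      exact fun l => step _ (.inl (.inr ⟨f, rfl⟩)) l _ rfl
    | halt =>
      exact fun l => step _ (.inr rfl) l _ rfl
  refine Function.Surjective.countable (f := fun l => (ev l).headD .halt) fun q => ?_
  obtain ⟨l, h⟩ := key q []
  exact ⟨l, by simp [h]⟩

/-- The machines whose tapes, control states and memory values are numbered. -/
abbrev MachineCode (k : ℕ) : Type :=
  Σ w l s : ℕ, Fin w × Fin w × Fin l × Fin s × (Fin l → Option (Fin l × Fin l)) ×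
    (Fin l → TM2.Stmt (fun _ : Fin k ⊕ Fin w => Bool) (Fin l) (Fin s))

/-- The machine with a given code. -/
abbrev MachineCode.machine {k : ℕ} : MachineCode k → OracleTM k
  | ⟨w, l, s, queryTape, outputTape, main, init, query, prog⟩ =>
    { W := Fin w, Λ := Fin l, σ := Fin s, queryTape, outputTape, main, init, query, prog }

/-- Numbering tapes, states and memory values does not change what a machine computes. -/
theorem OracleTM.exists_code {k : ℕ} (M : OracleTM k) : ∃ c : MachineCode k,
    ∀ A u y, M.Outputs A u y → c.machine.Outputs A u y := by
  obtain ⟨w, ⟨eW⟩⟩ := Finite.exists_equiv_fin M.W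
  obtain ⟨l, ⟨eΛ⟩⟩ := Finite.exists_equiv_fin M.Λ
  obtain ⟨s, ⟨eσ⟩⟩ := Finite.exists_equiv_fin M.σ
  let e : Fin k ⊕ M.W → Fin k ⊕ Fin w := Sum.map id eW
  have he : e.Injective := Function.injective_id.sumMap eW.injective
  let c : MachineCode k := ⟨w, l, s, eW M.queryTape, eW M.outputTape, eΛ M.main, eσ M.init,
    fun i => (M.query (eΛ.symm i)).map (Prod.map eΛ eΛ),
    fun i => trStmt e eσ.symm (fun _ v => eσ v) eΛ none (M.prog (eΛ.symm i))⟩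
  refine ⟨c, fun A u y ⟨n, hn, hy⟩ => ?_⟩
  have h0 : (c.machine.initCfg u).stk ∘ e = (M.initCfg u).stk := by
    funext i
    cases i <;> rfl
  obtain ⟨t, -, m', S', h1, h2, -⟩ := Routine.simulate (F := M.toRoutine)
    (G := c.machine.toRoutine) (e := e) he rfl (get := eσ.symm) (set := fun _ v => eσ v)
    (fun _ v => eσ.symm_apply_apply v) (φ := eΛ) (h := none)
    (fun l => by simp [c]) (fun l _ => by simp [c]) A n M.main (eσ M.init)
    (c.machine.initCfg u).stk (by
      rw [h0, eσ.symm_apply_apply]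
      rw [M.run_eq] at hn
      exact hn)
  rw [h0, eσ.symm_apply_apply] at h2
  have h3 : c.machine.run A u t = ⟨none, m', S'⟩ := by
    rw [OracleTM.run_eq]
    exact h1
  refine ⟨t, by rw [h3], ?_⟩
  rw [h3, ← hy, M.run_eq]
  exact congrFun h2 (Sum.inr M.outputTape)

/-- A polynomial-time function is determined by the code of a machine that computes it. -/
theorem FP.countable (k : ℕ) : {f | FP k f}.Countable := by
  classical
  let F : MachineCode k → Language Bool → (Fin k → List Bool) → List Bool := fun c A u =>
    if h : ∃ y, c.machine.Outputs A u y then h.choose else []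
  refine (Set.countable_range F).mono ?_
  rintro f ⟨M, -, hM⟩
  obtain ⟨c, hc⟩ := M.exists_code
  refine ⟨c, ?_⟩
  funext A u
  have h : ∃ y, c.machine.Outputs A u y := ⟨_, hc A u _ (hM A u)⟩
  simp only [F, dif_pos h]
  exact h.choose_spec.unique (hc A u _ (hM A u))

instance countable_polynomial_nat : Countable (Polynomial ℕ) := by
  rw [← Cardinal.mk_le_aleph0_iff]
  exact Polynomial.cardinalMk_le_max.trans (by simp)

/-! ### A language hidden among two oracles -/

section mixedOracle

/-- The oracle that consists of two parts, marked by the first bit.  On strings of length `n`, the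
part with the mark `y (.inl n)` is `L`, and the other part is given by the values of `y` on these
strings. -/
def mixedOracle (L : Language Bool) (y : ℕ ⊕ List Bool → Bool) : Language Bool :=
  {w | ∃ i q, w = i :: q ∧ if i = y (.inl q.length) then q ∈ L else y (.inr q) = true}

theorem cons_mem_mixedOracle {L : Language Bool} {y : ℕ ⊕ List Bool → Bool} {i : Bool}
    {q : List Bool} : i :: q ∈ mixedOracle L y ↔
      if i = y (.inl q.length) then q ∈ L else y (.inr q) = true := by
  constructor
  · rintro ⟨i, q, h, h'⟩
    obtain ⟨rfl, rfl⟩ := List.cons.inj h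
    exact h'
  · exact fun h => ⟨i, q, rfl, h⟩

theorem nil_notMem_mixedOracle {L : Language Bool} {y : ℕ ⊕ List Bool → Bool} :
    [] ∉ mixedOracle L y := by
  rintro ⟨i, q, h, -⟩
  cases h

/-- The length of the strings to which a coordinate of the parameter of `mixedOracle` pertains. -/
abbrev level : ℕ ⊕ List Bool → ℕ := Sum.elim id List.length

theorem mem_mixedOracle_congr {L : Language Bool} {y y' : ℕ ⊕ List Bool → Bool} {n : ℕ}
    (h : ∀ i, level i ≤ n → y i = y' i) {w : List Bool} (hw : w.length ≤ n + 1) :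
    w ∈ mixedOracle L y ↔ w ∈ mixedOracle L y' := by
  cases w with
  | nil => exact iff_of_false nil_notMem_mixedOracle nil_notMem_mixedOracle
  | cons i q =>
    have hq : q.length ≤ n := by simpa using hw
    rw [cons_mem_mixedOracle, cons_mem_mixedOracle, h (.inl q.length) hq, h (.inr q) hq]

/-- One bit of advice suffices to find `L`. -/
theorem mem_BPPCoinAdviceLog_mixedOracle (L : Language Bool) (y : ℕ ⊕ List Bool → Bool) :
    L ∈ BPPCoinAdviceLog (mixedOracle L y) := by
  obtain ⟨M, hM, h⟩ := FP.cases (FP.proj (2 : Fin 3)) (FP.const [])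
    ((FP.proj (0 : Fin 3)).cons true).query ((FP.proj (0 : Fin 3)).cons false).query
  refine ⟨M, hM, 0, fun _ => 1, fun n _ => [y (.inl n)], ?_, fun _ _ _ => rfl, fun n => ?_⟩
  · refine IsBigO.of_bound 1 (eventually_atTop.2 ⟨3, fun n hn => ?_⟩)
    have h1 : (1 : ℝ) ≤ Real.log n := by
      rw [Real.le_log_iff_exp_le (by positivity)]
      have h3 : (3 : ℝ) ≤ n := by exact_mod_cast hn
      linarith [Real.exp_one_lt_d9]
    rw [Real.norm_of_nonneg (by positivity), Real.norm_of_nonneg (by linarith)]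
    simpa using h1
  · have key : ∀ r x : List Bool, x.length = n →
        M.Outputs (mixedOracle L y) ![x, r, [y (.inl n)]] (charBit L x) := fun r x hx => by
      have h' := h (mixedOracle L y) ![x, r, [y (.inl n)]]
      have e : charBit (mixedOracle L y) (y (.inl n) :: x) = charBit L x := by
        simp [charBit, cons_mem_mixedOracle, hx]
      rw [← e]
      simp only [Matrix.cons_val, List.head?_cons, Option.elim_some, Matrix.cons_val_zero] at h'
      cases hb : y (.inl n) <;> rw [hb] at h' <;> exact h'
    have h1 : coinProb ((0 : Polynomial ℕ).eval n) (fun _ => True) = 1 := by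
      simp [coinProb]
    calc (5 / 6 : ℝ) ≤ 1 := by norm_num
      _ = _ := h1.symm
      _ ≤ _ := coinProb_mono fun r _ _ => key r

open Topology in
/-- Only finitely many coordinates have a level that is at most `n`. -/
theorem setOf_level_le_mem_nhds (y : ℕ ⊕ List Bool → Bool) (n : ℕ) :
    {y' | ∀ i, level i ≤ n → y' i = y i} ∈ 𝓝 y := by
  have hfin : {i : ℕ ⊕ List Bool | level i ≤ n}.Finite := by
    refine (((Set.finite_Iic n).image Sum.inl).union
      ((List.finite_length_le Bool n).image Sum.inr)).subset ?_
    rintro (m | q) h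
    · exact .inl ⟨m, h, rfl⟩
    · exact .inr ⟨q, h, rfl⟩
  have := set_pi_mem_nhds (x := y) (s := fun i => {y i}) hfin fun i _ =>
    (isOpen_discrete {y i}).mem_nhds rfl
  exact mem_of_superset this fun y' h i hi => h i hi

/-- The parameters for which a given probabilistic machine decides `L` form a closed set, because
its computations on a single input depend on finitely many coordinates. -/
theorem isClosed_setOf_mixedOracle (L : Language Bool)
    {f : Language Bool → (Fin 2 → List Bool) → List Bool} (hf : FP 2 f) (t : Polynomial ℕ) :
    IsClosed {y | ∀ x : List Bool, 2 / 3 ≤ coinProb (t.eval x.length)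
      fun r => f (mixedOracle L y) ![x, r] = charBit L x} := by
  obtain ⟨Q, hQ⟩ := hf.exists_query_bound
  rw [Set.ofPred_forall]
  refine isClosed_iInter fun x => ?_
  rw [← isOpen_compl_iff, isOpen_iff_mem_nhds]
  intro y hy
  refine mem_of_superset
    (setOf_level_le_mem_nhds y (Q.eval (x.length + t.eval x.length))) fun y' hy' h => hy ?_
  refine le_trans h (coinProb_mono fun r hr h => ?_)
  rw [← h]
  refine hQ _ _ _ fun q hq => mem_mixedOracle_congr (fun i hi => (hy' i hi).symm) ?_
  rw [Fin.sum_univ_two] at hq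
  change q.length ≤ Q.eval (x.length + r.length) at hq
  rw [hr] at hq
  omega

/-- By the Baire category theorem, if `L` is in `BPP` relative to all these oracles, then one
machine decides `L` relative to all of them with a given finite part. -/
theorem exists_forall_agree {L : Language Bool} (h : ∀ y, L ∈ BPP (mixedOracle L y)) :
    ∃ f, FP 2 f ∧ ∃ (t : Polynomial ℕ) (y₀ : ℕ ⊕ List Bool → Bool) (n : ℕ),
      ∀ y, (∀ i, level i ≤ n → y i = y₀ i) → ∀ x : List Bool,
        2 / 3 ≤ coinProb (t.eval x.length)
          fun r => f (mixedOracle L y) ![x, r] = charBit L x := by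
  have := (FP.countable 2).to_subtype
  obtain ⟨⟨⟨f, hf⟩, t⟩, y₀, hy₀⟩ := nonempty_interior_of_iUnion_of_closed
    (f := fun p : {f | FP 2 f} × Polynomial ℕ => {y | ∀ x : List Bool,
      2 / 3 ≤ coinProb (p.2.eval x.length)
        fun r => p.1.1 (mixedOracle L y) ![x, r] = charBit L x})
    (fun p => isClosed_setOf_mixedOracle L p.1.2 p.2) (by
      refine Set.eq_univ_of_forall fun y => ?_
      obtain ⟨M, hM, t, ht⟩ := h y
      obtain ⟨f, hf, hMf⟩ := hM.exists_fp
      exact Set.mem_iUnion.2 ⟨(⟨f, hf⟩, t), fun x =>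
        (ht x).trans (coinProb_mono fun r _ hr => (hMf _ _).unique hr)⟩)
  rw [mem_interior_iff_mem_nhds, nhds_pi, Filter.mem_pi] at hy₀
  obtain ⟨I, hI, s, hs, hsub⟩ := hy₀
  obtain ⟨n, hn⟩ := (hI.image level).bddAbove
  refine ⟨f, hf, t, y₀, n, fun y hy => hsub fun i hi => ?_⟩
  rw [hy i (hn ⟨i, hi, rfl⟩)]
  exact mem_of_mem_nhds (hs i)

end mixedOracle

/-- Finitely many strings may be treated according to a table. -/
theorem FP.table {k : ℕ} {g h : Language Bool → (Fin k → List Bool) → List Bool} (hh : FP k h)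
    (n : ℕ) (hg : FP k g) (tbl : List Bool → Bool) :
    FP k fun A u => if (g A u).length ≤ n then [tbl (g A u)] else h A u := by
  induction n generalizing g tbl with
  | zero =>
    convert hg.cases (FP.const [tbl []]) hh hh using 3 with A u
    cases g A u <;> simp
  | succ n ih =>
    convert hg.cases (FP.const [tbl []]) (ih hg.tail fun q => tbl (true :: q))
      (ih hg.tail fun q => tbl (false :: q)) using 3 with A u
    rcases g A u with _ | ⟨_ | _, q⟩ <;> simp <;> congr

theorem cons_mem_joinOracle {A₀ A₁ : Language Bool} {i : Bool} {q : List Bool} :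
    i :: q ∈ joinOracle A₀ A₁ ↔ q ∈ bif i then A₁ else A₀ := by
  constructor
  · rintro ⟨q, ⟨h, h'⟩ | ⟨h, h'⟩⟩ <;> obtain ⟨rfl, rfl⟩ := List.cons.inj h <;> exact h'
  · intro h
    cases i
    · exact ⟨q, .inl ⟨rfl, h⟩⟩
    · exact ⟨q, .inr ⟨rfl, h⟩⟩

/-- Outside a finite table, the machine of `exists_forall_agree` cannot tell where `L` is, nor what
the other oracle is: with the table in place of the short queries it is a selector. -/
theorem HasSelector.of_forall_mem_BPP {L : Language Bool}
    (h : ∀ R, L ∈ BPPCoinAdviceLog R → L ∈ BPP R) : HasSelector L := by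
  classical
  obtain ⟨f, hf, t, y₀, n, hy₀⟩ :=
    exists_forall_agree fun y => h _ (mem_BPPCoinAdviceLog_mixedOracle L y)
  -- Queries of length at most `n + 1`, that is a mark and a string of length at most `n`, are
  -- answered from the table, the others by the oracle at hand.
  obtain ⟨S, hS, hSf⟩ := hf.subst (j := 2)
    ((FP.proj (0 : Fin 3)).query.table (n + 1) (FP.proj (0 : Fin 3))
      fun q => decide (q ∈ mixedOracle L y₀))
    (fun A u => by split_ifs; exacts [⟨_, rfl⟩, ⟨_, rfl⟩]) id
  refine ⟨S, hS, t, fun x A₀ A₁ hA => ?_⟩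
  obtain ⟨c, hc⟩ : ∃ c : Bool, L = bif c then A₁ else A₀ := by
    rcases hA with h | h
    exacts [⟨false, h⟩, ⟨true, h⟩]
  -- The simulated oracle is a mixed one: `y` puts `L` on the side `c` above the level `n`.
  let y : ℕ ⊕ List Bool → Bool := fun i => if level i ≤ n then y₀ i else
    i.elim (fun _ => c) fun q => decide (q ∈ bif c then A₀ else A₁)
  have hy : ∀ i, level i ≤ n → y i = y₀ i := fun i hi => if_pos hi
  refine (hy₀ y hy x).trans (coinProb_mono fun r _ hr => ?_)
  rw [← hr]
  have e : mixedOracle L y = {q | (if q.length ≤ n + 1 then [decide (q ∈ mixedOracle L y₀)]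
    else charBit (joinOracle A₀ A₁) q) = [true]} := ?_
  · rw [e]
    exact hSf (joinOracle A₀ A₁) ![x, r]
  ext q
  change _ ↔ (if q.length ≤ n + 1 then [decide (q ∈ mixedOracle L y₀)]
    else charBit (joinOracle A₀ A₁) q) = [true]
  split_ifs with hq
  · rw [mem_mixedOracle_congr hy hq]
    simp
  · rcases q with _ | ⟨i, q⟩
    · simp at hq
    · have hq' : ¬ q.length ≤ n := by simpa using hq
      have h1 : y (.inl q.length) = c := if_neg hq'
      have h2 : y (.inr q) = decide (q ∈ bif c then A₀ else A₁) := if_neg hq'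
      have h3 : (charBit (joinOracle A₀ A₁) (i :: q) = [true]) ↔ i :: q ∈ joinOracle A₀ A₁ := by
        rw [charBit, List.cons.injEq, decide_eq_true_iff]
        exact and_iff_left rfl
      rw [cons_mem_mixedOracle, h1, h2, h3, cons_mem_joinOracle, hc]
      cases c <;> cases i <;> simp

theorem mainTheorem2 (L : Language Bool) (hL : Paddable L) :
    HasSelector L ↔ ∀ R : Language Bool, L ∈ BPPCoinAdviceLog R → L ∈ BPP R :=
  ⟨fun hS _ hR => hS.mem_BPP hL hR, HasSelector.of_forall_mem_BPP⟩

end
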